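/- For a group $H$ and an integer $r\ge 1$, let $\mathrm{FSym}(Y)$ denote the group of finitely supported permutations of a set $Y$, and let the lampjuggler over $H$ be the semidirect product $\mathrm{FSym}(H\times\{1,\dots,r\})\rtimes H$, where $H$ acts by $(h\cdot\sigma)(y)=h\cdot\sigma(h^{-1}\cdot y)$ with $h\cdot(x,i)=(hx,i)$. An orbit equivalence coupling from a countable group $G$ to a countable group $K$ is an atomless standard probability space $(X,\mu)$ with free probability measure preserving actions of $G$ and $K$ such that $G\cdot x=K\cdot x$ for almost every $x\in X$. Its cocycles $c_{G,K}\colon G\times X\to K$ and $c_{K,G}\colon K\times X\to G$ are defined, for every $g\in G$, $k\in K$ and almost every $x\in X$, by $g\cdot x=c_{G,K}(g,x)\cdot x$ and $k\cdot x=c_{K,G}(k,x)\cdot x$. If $G$ and $K$ are finitely generated and $\varphi,\psi\colon\mathbb R_+\to\mathbb R_+$ are non-decreasing, the coupling is $(\varphi,\psi)$-integrable if for all finite generating sets $S_G$ of $G$ and $S_K$ of $K$, all $g\in G$ and all $k\in K$ there are constants $C_g,C'_k>0$ with $$\int_X\varphi\left(\frac{|c_{G,K}(g,x)|_{S_K}}{C_g}\right)d\mu(x)<\infty\quad\text{and}\quad\int_X\psi\left(\frac{|c_{K,G}(k,x)|_{S_G}}{C'_k}\right)d\mu(x)<\infty,$$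 where $|\cdot|_S$ denotes word length with respect to $S$ (the condition does not depend on the choice of the generating sets). Theorem. Let $d_1,d_2,r\ge 1$ be integers. The lampjuggler $\mathrm{FSym}(\mathbb Z^{d_1}\times\{1,\dots,r\})\rtimes\mathbb Z^{d_1}$ is finitely generated, and there exists an orbit equivalence coupling from it to $\mathbb Z^{d_2}$ such that, for every $\varepsilon>0$, this same coupling is $(\varphi,\psi)$-integrable for all non-decreasing functions $\varphi,\psi\colon\mathbb R_+\to\mathbb R_+$ such that, for all sufficiently large $x$, $$\varphi(x)=\frac{\ln(x)^{1/d_1}}{\ln(\ln(x))^{1+1/d_1+\varepsilon}}\quad\text{and}\quad\psi(x)=x^{x^{d_1/(d_1+1)}}.$$ -/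

import Mathlib

open MeasureTheory Filter
open scoped NNReal ENNReal

noncomputable section

/-- The group of finitely supported permutations of a set `Y`. -/
def FSym (Y : Type*) : Subgroup (Equiv.Perm Y) where
  carrier := {σ | {y | σ y ≠ y}.Finite}
  one_mem' := by simp
  mul_mem' := by
    intro a b ha hb
    refine (ha.union hb).subset ?_
    intro y hy
    by_contra h
    simp only [Set.mem_union, Set.mem_ofPred_eq, not_or, not_not] at h
    exact hy (by simp [Equiv.Perm.mul_apply, h.1, h.2])
  inv_mem' := by
    intro a ha
    refine Set.Finite.subset ha ?_
    intro y hy h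
    exact hy (Equiv.Perm.inv_eq_iff_eq.2 h.symm)

/-- The permutation `(x, i) ↦ (h x, i)` of `H × {1, …, r}`. -/
def jugglerShift (r : ℕ) {H : Type*} [Group H] (h : H) : Equiv.Perm (H × Fin r) :=
  Equiv.prodCongr (Equiv.mulLeft h) (Equiv.refl (Fin r))

theorem jugglerShift_one (r : ℕ) {H : Type*} [Group H] :
    jugglerShift r (1 : H) = 1 := by
  ext x <;> simp [jugglerShift]

theorem jugglerShift_mul (r : ℕ) {H : Type*} [Group H] (h k : H) :
    jugglerShift r (h * k) = jugglerShift r h * jugglerShift r k := by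
  ext x <;> simp [jugglerShift, mul_assoc]

theorem conj_mem_FSym {Y : Type*} (τ σ : Equiv.Perm Y) (hσ : σ ∈ FSym Y) :
    τ * σ * τ⁻¹ ∈ FSym Y := by
  refine (Set.Finite.image τ hσ).subset ?_
  intro y hy
  refine ⟨τ⁻¹ y, ?_, by simp⟩
  intro h
  exact hy (by rw [Equiv.Perm.mul_apply, Equiv.Perm.mul_apply, h]; simp)

/-- The action of `H` on finitely supported permutations of `H × {1, …, r}` induced by
left translation: `(h · σ)(y) = h · σ(h⁻¹ · y)`. -/
def jugglerAction (r : ℕ) (H : Type*) [Group H] : H →* MulAut (FSym (H × Fin r)) where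
  toFun h :=
    { toFun := fun σ => ⟨jugglerShift r h * σ.1 * (jugglerShift r h)⁻¹,
        conj_mem_FSym _ _ σ.2⟩
      invFun := fun σ => ⟨(jugglerShift r h)⁻¹ * σ.1 * jugglerShift r h, by
        simpa using conj_mem_FSym (jugglerShift r h)⁻¹ σ.1 σ.2⟩
      left_inv := fun σ => Subtype.ext (by group)
      right_inv := fun σ => Subtype.ext (by group)
      map_mul' := fun σ τ => Subtype.ext (by simp [mul_assoc]) }
  map_one' := by
    ext1 σ
    exact Subtype.ext (by simp [jugglerShift_one])
  map_mul' h k := by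
    ext1 σ
    exact Subtype.ext (by simp [jugglerShift_mul, mul_assoc])

/-- The lampjuggler over `H`: the semidirect product `FSym(H × {1, …, r}) ⋊ H`. -/
abbrev Lampjuggler (r : ℕ) (H : Type*) [Group H] : Type _ :=
  FSym (H × Fin r) ⋊[jugglerAction r H] H

/-- The free abelian group `ℤ^d`, written multiplicatively. -/
abbrev FreeAb (d : ℕ) : Type := Multiplicative (Fin d → ℤ)

/-- The word length `|g|_S`: the least length of a word in `S ∪ S⁻¹` that represents `g`
(used only for generating sets `S`). -/
def wordLength {G : Type*} [Group G] (S : Set G) (g : G) : ℕ :=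
  sInf {n | ∃ l : List G, l.length = n ∧ (∀ s ∈ l, s ∈ S ∨ s⁻¹ ∈ S) ∧ l.prod = g}

/-- An orbit equivalence coupling between `H` and `K`: an atomless standard probability space
with free probability measure preserving actions of `H` and `K` such that almost every point has
the same `H`-orbit and `K`-orbit. -/
structure OECoupling (H K : Type*) [Group H] [Group K] where
  X : Type
  [measurableSpace : MeasurableSpace X]
  [standardBorel : StandardBorelSpace X]
  μ : Measure X
  [isProbability : IsProbabilityMeasure μ]
  noAtoms : ∀ x : X, μ {x} = 0
  [actH : MulAction H X]
  [actK : MulAction K X]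
  measurePreservingH : ∀ h : H, MeasurePreserving (fun x : X => h • x) μ μ
  measurePreservingK : ∀ k : K, MeasurePreserving (fun x : X => k • x) μ μ
  freeH : ∀ (h : H) (x : X), h • x = x → h = 1
  freeK : ∀ (k : K) (x : X), k • x = x → k = 1
  orbit_eq : ∀ᵐ x ∂μ, MulAction.orbit H x = MulAction.orbit K x

namespace OECoupling

attribute [instance] measurableSpace standardBorel isProbability actH actK

variable {H K : Type*} [Group H] [Group K]

open Classical in
/-- The cocycle `c_{H,K}`: `h • x = c_{H,K}(h, x) • x` for almost every `x` (by freeness this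
determines it; it takes the value `1` on the null set where no such element exists). -/
def cocycleHK (C : OECoupling H K) (h : H) (x : C.X) : K :=
  if e : ∃ k : K, k • x = h • x then e.choose else 1

open Classical in
/-- The cocycle `c_{K,H}`: `k • x = c_{K,H}(k, x) • x` for almost every `x`. -/
def cocycleKH (C : OECoupling H K) (k : K) (x : C.X) : H :=
  if e : ∃ h : H, h • x = k • x then e.choose else 1

/-- The coupling is `(φ, ψ)`-integrable from `H` to `K`. Both groups are finitely generated, and
the integrability conditions are required for all finite generating sets. -/
def IsIntegrable (C : OECoupling H K) (φ ψ : ℝ≥0 → ℝ≥0) : Prop :=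
  Group.FG H ∧ Group.FG K ∧
  (∀ S : Set K, S.Finite → Subgroup.closure S = ⊤ → ∀ h : H, ∃ c : ℝ≥0, 0 < c ∧
    ∫⁻ x, (φ ((wordLength S (C.cocycleHK h x) : ℝ≥0) / c) : ℝ≥0∞) ∂C.μ < ∞) ∧
  (∀ S : Set H, S.Finite → Subgroup.closure S = ⊤ → ∀ k : K, ∃ c : ℝ≥0, 0 < c ∧
    ∫⁻ x, (ψ ((wordLength S (C.cocycleKH k x) : ℝ≥0) / c) : ℝ≥0∞) ∂C.μ < ∞)

end OECoupling

end

/-! Both groups are made to act on one space of digit sequences. If each tile `T (n + 1)` is a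
disjoint union of `k n` left translates of `T n`, the first `n` digits encode an element of `T n`.
When the tiles are Følner, right multiplication by `g⁻¹` is, for almost every sequence, a change of
finitely many digits. This is a free action preserving the uniform product measure, and its orbits
are the classes of sequences with a common tail. Two groups with Følner tilings for the same `k`
therefore share their orbits (`tilingCoupling`). If `n` is the first level at which `g⁻¹` keeps the
encoded element in its tile, the cocycle is a quotient of two elements of the `n`-th tile of the
other group. Integrability thus reduces to convergence of a series of terms φ(diameter at `n + 1`) ·
(boundary at `n`) (`lintegral_le_of_rel`).

For the lampjuggler, the `n`-th tile (`n ≥ 1`) has position in a box of 2^n points and permutation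
supported over that box (`exists_lampTiling`). It has (2^n r)! 2^n elements, boundary O(2^(-n/d₁))
and diameter O(2^(n(1+1/d₁))). For ℤ^d₂ the tiles are boxes with the same cardinalities, the
directions being extended in turn. Their diameter is at most a multiple of the cardinality, whose
logarithm is O(n 2^n), and the boundary at level n + d₂ is O(2^(-n 2^n)). The series for φ is then
dominated by ∑ n^(-1-ε) (`summable_log_profile`), and the one for ψ converges after rescaling its
argument by a small constant (`exists_summable_exp_profile`). The tilings involve neither ε nor φ
nor ψ, so one coupling serves all of them. -/

/-! ### Tilings and the partial action on digit sequences -/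

/-- A sequence of finite sets `T n` in a group, `T 0 = {1}`, such that `T (n + 1)` is partitioned
into the left translates `f n i * T n`, for `i < k n`. -/
structure Tiling (k : ℕ → ℕ) (G : Type*) [Group G] where
  f : ∀ n, Fin (k n) → G
  T : ℕ → Finset G
  T_zero : T 0 = {1}
  mem_succ : ∀ n g, g ∈ T (n + 1) ↔ ∃ i, ∃ t ∈ T n, f n i * t = g
  inj : ∀ n i j, ∀ t ∈ T n, ∀ t' ∈ T n, f n i * t = f n j * t' → i = j

/-- Sequences of digits, the `n`-th digit being less than `k n`. -/
abbrev Digits (k : ℕ → ℕ) : Type := ∀ n, Fin (k n)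

/-- The sequence that agrees with `y` before `n` and with `x` from `n` on. -/
def splice {k : ℕ → ℕ} (n : ℕ) (y x : Digits k) : Digits k := fun i => if i < n then y i else x i

namespace Tiling

variable {k : ℕ → ℕ} {G : Type*} [Group G] (D : Tiling k G)

/-- The element of the `n`-th tile that is encoded by the first `n` digits. -/
def t : ℕ → Digits k → G
  | 0, _ => 1
  | n + 1, x => D.f n (x n) * t n x

theorem t_succ (n : ℕ) (x : Digits k) : D.t (n + 1) x = D.f n (x n) * D.t n x := rfl

theorem t_mem (n : ℕ) (x : Digits k) : D.t n x ∈ D.T n := by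
  induction n with
  | zero => simp [t, D.T_zero]
  | succ n ih => exact (D.mem_succ n _).2 ⟨x n, _, ih, rfl⟩

theorem t_congr {n : ℕ} {x y : Digits k} (h : ∀ i < n, x i = y i) : D.t n x = D.t n y := by
  induction n with
  | zero => rfl
  | succ n ih =>
    rw [t_succ, t_succ, ih fun i hi => h i (by omega), h n (by omega)]

theorem digit_eq {n : ℕ} {x y : Digits k} (h : D.t (n + 1) x = D.t (n + 1) y) : x n = y n :=
  D.inj n _ _ _ (D.t_mem n x) _ (D.t_mem n y) h

theorem eq_of_t_eq {n : ℕ} {x y : Digits k} (h : D.t n x = D.t n y) : ∀ i < n, x i = y i := by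
  induction n with
  | zero => intro i hi; omega
  | succ n ih =>
    have h1 := D.digit_eq h
    rw [t_succ, t_succ, h1] at h
    intro i hi
    rcases Nat.lt_succ_iff_lt_or_eq.1 hi with hi | rfl
    · exact ih (mul_left_cancel h) i hi
    · exact h1

theorem exists_t_eq [∀ n, NeZero (k n)] {n : ℕ} {g : G} (hg : g ∈ D.T n) :
    ∃ x, D.t n x = g := by
  induction n generalizing g with
  | zero =>
    rw [D.T_zero, Finset.mem_singleton] at hg
    exact ⟨fun _ => 0, hg.symm⟩
  | succ n ih =>
    obtain ⟨i, s, hs, rfl⟩ := (D.mem_succ n g).1 hg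
    obtain ⟨x, rfl⟩ := ih hs
    refine ⟨Function.update x n i, ?_⟩
    rw [t_succ, Function.update_self]
    congr 1
    exact D.t_congr fun j hj => Function.update_of_ne (by omega) _ _

theorem t_splice (n : ℕ) (y x : Digits k) : D.t n (splice n y x) = D.t n y :=
  D.t_congr fun i hi => by simp [splice, hi]

/-- Common later digits contribute the same left factor, which cancels in the quotient. The group
element relating two sequences with a common tail can hence be read off at any level past their last
difference. -/
theorem t_mul_inv_of_tail {n m : ℕ} (hnm : n ≤ m) {x y : Digits k} (h : ∀ i ≥ n, y i = x i) :
    (D.t m y)⁻¹ * D.t m x = (D.t n y)⁻¹ * D.t n x := by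
  induction m, hnm using Nat.le_induction with
  | base => rfl
  | succ m hm ih => rw [← ih, t_succ, t_succ, h m hm]; group

/-- The sequence `y` is the image of `x` under `g`. -/
def Rel (g : G) (x y : Digits k) : Prop := ∀ᶠ n in atTop, D.t n y = D.t n x * g⁻¹

variable {D}

theorem Rel.one (x : Digits k) : D.Rel 1 x x := by simp [Rel]

theorem Rel.comp {g h : G} {x y z : Digits k} (h₁ : D.Rel g x y) (h₂ : D.Rel h y z) :
    D.Rel (h * g) x z := by
  filter_upwards [h₁, h₂] with n e₁ e₂
  rw [e₂, e₁]; group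

theorem Rel.inv {g : G} {x y : Digits k} (h : D.Rel g x y) : D.Rel g⁻¹ y x := by
  filter_upwards [h] with n e
  rw [e]; group

theorem Rel.unique {g : G} {x y z : Digits k} (h₁ : D.Rel g x y) (h₂ : D.Rel g x z) : y = z := by
  funext i
  obtain ⟨n, ⟨e₁, e₂⟩, hn⟩ := ((h₁.and h₂).and (eventually_gt_atTop i)).exists
  exact D.eq_of_t_eq (e₁.trans e₂.symm) i hn

theorem Rel.unique_group {g h : G} {x y : Digits k} (h₁ : D.Rel g x y) (h₂ : D.Rel h x y) :
    g = h := by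
  obtain ⟨n, e₁, e₂⟩ := (h₁.and h₂).exists
  exact inv_injective (mul_left_cancel (e₁.symm.trans e₂))

/-- Comparing two consecutive levels puts the same element of `T (n + 1)` in the translates indexed
by `y n` and by `x n`; translates are disjoint. -/
theorem Rel.tail {g : G} {x y : Digits k} (h : D.Rel g x y) : ∀ᶠ n in atTop, y n = x n := by
  obtain ⟨N, hN⟩ := eventually_atTop.1 h
  filter_upwards [eventually_ge_atTop N] with n hn
  have h1 := hN n hn
  have h2 := hN (n + 1) (by omega)
  rw [t_succ, t_succ, h1, mul_assoc] at h2
  exact D.inj n _ _ _ (h1 ▸ D.t_mem n y) _ (h1 ▸ D.t_mem n y) h2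

theorem rel_of_tail {n : ℕ} {x y : Digits k} (h : ∀ i ≥ n, y i = x i) :
    D.Rel ((D.t n y)⁻¹ * D.t n x) x y := by
  filter_upwards [eventually_ge_atTop n] with m hm
  rw [← D.t_mul_inv_of_tail hm h]; group

theorem exists_rel_of_tail {x y : Digits k} (h : ∀ᶠ n in atTop, y n = x n) :
    ∃ g, D.Rel g x y := by
  obtain ⟨N, hN⟩ := eventually_atTop.1 h
  exact ⟨_, rel_of_tail hN⟩

theorem Rel.eq_of_tail {g : G} {n : ℕ} {x y : Digits k} (h : D.Rel g x y)
    (hy : ∀ i ≥ n, y i = x i) : g = (D.t n y)⁻¹ * D.t n x :=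
  h.unique_group (rel_of_tail hy)

theorem rel_splice {g : G} {n : ℕ} {x z : Digits k} (h : D.t n z = D.t n x * g⁻¹) :
    D.Rel g x (splice n z x) := by
  have : D.Rel _ x (splice n z x) := rel_of_tail (n := n) fun i hi => by simp [splice, hi.not_gt]
  rw [t_splice, h] at this
  simpa using this

theorem Rel.tail_of_mem [∀ n, NeZero (k n)] {g : G} {n : ℕ} {x y : Digits k} (h : D.Rel g x y)
    (hn : D.t n x * g⁻¹ ∈ D.T n) : ∀ i ≥ n, y i = x i := by
  obtain ⟨z, hz⟩ := D.exists_t_eq hn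
  rw [h.unique (rel_splice hz)]
  intro i hi
  simp [splice, hi.not_gt]

theorem exists_rel_iff [∀ n, NeZero (k n)] {g : G} {x : Digits k} :
    (∃ y, D.Rel g x y) ↔ ∃ n, D.t n x * g⁻¹ ∈ D.T n := by
  constructor
  · rintro ⟨y, hy⟩
    obtain ⟨n, hn⟩ := hy.exists
    exact ⟨n, hn ▸ D.t_mem n y⟩
  · rintro ⟨n, hn⟩
    obtain ⟨z, hz⟩ := D.exists_t_eq hn
    exact ⟨_, rel_splice hz⟩

variable (D)

/-- The points at which every element of the group acts. -/
def domain : Set (Digits k) := {x | ∀ g, ∃ y, D.Rel g x y}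

variable {D}

theorem mem_domain_of_tail {x y : Digits k} (hx : x ∈ D.domain)
    (h : ∀ᶠ n in atTop, y n = x n) : y ∈ D.domain := by
  intro g
  obtain ⟨g₀, hg₀⟩ := exists_rel_of_tail (D := D) h
  obtain ⟨z, hz⟩ := hx (g * g₀)
  refine ⟨z, ?_⟩
  have := hg₀.inv.comp hz
  simpa using this

end Tiling

/-! ### The product measure and Følner tilings -/

/-- The product of the uniform probability measures on digits. -/
noncomputable def digitMeasure (k : ℕ → ℕ) : Measure (Digits k) :=
  Measure.infinitePi fun _ => ProbabilityTheory.uniformOn Set.univ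

instance (k : ℕ → ℕ) [∀ n, NeZero (k n)] : IsProbabilityMeasure (digitMeasure k) := by
  unfold digitMeasure; infer_instance

theorem digitMeasure_cylinder {k : ℕ → ℕ} [∀ n, NeZero (k n)] (x : Digits k) (n : ℕ) :
    digitMeasure k (PiNat.cylinder x n) = ((∏ i ∈ Finset.range n, k i : ℕ) : ℝ≥0∞)⁻¹ := by
  rw [PiNat.cylinder_eq_pi, digitMeasure, Measure.infinitePi_pi _ (fun _ _ => .of_discrete)]
  have h (i : ℕ) : ProbabilityTheory.uniformOn (Set.univ : Set (Fin (k i))) {x i}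
      = (k i : ℝ≥0∞)⁻¹ := by
    rw [ProbabilityTheory.uniformOn_univ, Measure.count_singleton]
    simp
  simp_rw [h]
  push_cast
  exact (ENNReal.prod_inv_distrib fun i _ j _ _ => Or.inr (by simp)).symm

/-- The set `C` depends only on the first `n` digits. -/
def IsLevel {k : ℕ → ℕ} (n : ℕ) (C : Set (Digits k)) : Prop :=
  ∀ x y, (∀ i < n, x i = y i) → x ∈ C → y ∈ C

namespace IsLevel

variable {k : ℕ → ℕ} {n m : ℕ} {C : Set (Digits k)}

theorem measurableSet (h : IsLevel n C) : MeasurableSet C := by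
  apply IsOpen.measurableSet
  rw [(PiNat.isTopologicalBasis_cylinders fun i => Fin (k i)).isOpen_iff]
  exact fun x hx => ⟨_, ⟨x, n, rfl⟩, PiNat.self_mem_cylinder x n,
    fun y hy => h x y (fun i hi => (hy i hi).symm) hx⟩

theorem compl (h : IsLevel n C) : IsLevel n Cᶜ :=
  fun x y hxy hx hy => hx (h y x (fun i hi => (hxy i hi).symm) hy)

theorem mono (h : IsLevel n C) (hnm : n ≤ m) : IsLevel m C :=
  fun x y hxy => h x y fun i hi => hxy i (by omega)

theorem cylinder (x : Digits k) (n : ℕ) : IsLevel n (PiNat.cylinder x n) :=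
  fun _ _ hyz hy i hi => (hyz i hi).symm.trans (hy i hi)

end IsLevel

namespace Tiling

variable {k : ℕ → ℕ} {G : Type*} [Group G] (D : Tiling k G)

theorem isLevel_t (n : ℕ) (P : G → Prop) : IsLevel n {x | P (D.t n x)} := by
  intro x y hxy hx
  simpa [← D.t_congr hxy] using hx

theorem card_T (n : ℕ) : (D.T n).card = ∏ i ∈ Finset.range n, k i := by
  classical
  induction n with
  | zero => simp [D.T_zero]
  | succ n ih =>
    rw [Finset.prod_range_succ, ← ih, mul_comm]
    have : D.T (n + 1) = ((Finset.univ : Finset (Fin (k n))) ×ˢ D.T n).image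
        fun p => D.f n p.1 * p.2 := by
      ext g
      simp [D.mem_succ]
    rw [this, Finset.card_image_of_injOn, Finset.card_product, Finset.card_univ, Fintype.card_fin]
    rintro ⟨i, s⟩ hi ⟨j, s'⟩ hj h
    simp only [Finset.coe_product, Set.mem_prod, Finset.mem_coe] at hi hj
    obtain rfl := D.inj n i j s hi.2 s' hj.2 h
    simpa using h

theorem card_T_pos [∀ n, NeZero (k n)] (n : ℕ) : 0 < (D.T n).card := by
  rw [card_T]
  exact Finset.prod_pos fun i _ => NeZero.pos (k i)

open Classical in
theorem measure_t [∀ n, NeZero (k n)] (n : ℕ) (P : G → Prop) :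
    digitMeasure k {x | P (D.t n x)} = ((D.T n).filter P).card * ((D.T n).card : ℝ≥0∞)⁻¹ := by
  have h : {x | P (D.t n x)} = ⋃ g ∈ (D.T n).filter P, {x | D.t n x = g} := by
    ext x
    simp [D.t_mem]
  rw [h, measure_biUnion_finset]
  · rw [Finset.sum_congr rfl (g := fun _ => ((D.T n).card : ℝ≥0∞)⁻¹), Finset.sum_const,
      nsmul_eq_mul]
    intro g hg
    obtain ⟨x, rfl⟩ := D.exists_t_eq (Finset.mem_filter.1 hg).1
    have : {y | D.t n y = D.t n x} = PiNat.cylinder x n := by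
      ext y
      exact ⟨fun h => D.eq_of_t_eq h, fun h => D.t_congr h⟩
    rw [this, digitMeasure_cylinder, card_T]
  · intro g _ g' _ hne
    exact Set.disjoint_left.2 fun x hx hx' => hne (hx.symm.trans hx')
  · exact fun g _ => (D.isLevel_t n (· = g)).measurableSet

/-- Right multiplication by `g⁻¹` sends the prefixes counted on the left injectively to prefixes of
points of `C`, and all prefixes of length `n` have equal mass. -/
theorem measure_shift_le [∀ n, NeZero (k n)] {n : ℕ} {C : Set (Digits k)} (hC : IsLevel n C)
    (g : G) : digitMeasure k {x | ∃ y ∈ C, D.t n y = D.t n x * g⁻¹} ≤ digitMeasure k C := by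
  classical
  have h : C = {x | ∃ y ∈ C, D.t n y = D.t n x} := by
    ext x
    exact ⟨fun hx => ⟨x, hx, rfl⟩, fun ⟨y, hy, hyx⟩ => hC y x (D.eq_of_t_eq hyx) hy⟩
  conv_rhs => rw [h]
  rw [D.measure_t n fun s => ∃ y ∈ C, D.t n y = s * g⁻¹,
    D.measure_t n fun s => ∃ y ∈ C, D.t n y = s]
  gcongr ?_ * _
  rw [Nat.cast_le]
  refine Finset.card_le_card_of_injOn (· * g⁻¹) ?_ fun a _ b _ h => mul_right_cancel h
  intro s hs
  simp only [Finset.coe_filter, Set.mem_ofPred_eq] at hs ⊢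
  obtain ⟨_, y, hy, e⟩ := hs
  exact ⟨e ▸ D.t_mem n y, y, hy, e⟩

theorem setOf_rel_eq [∀ n, NeZero (k n)] {m : ℕ} {C : Set (Digits k)} (hC : IsLevel m C) (g : G) :
    {x | ∃ y ∈ C, D.Rel g x y} = ⋃ j, {x | ∃ y ∈ C, D.t (m + j) y = D.t (m + j) x * g⁻¹} := by
  ext x
  simp only [Set.mem_ofPred_eq, Set.mem_iUnion]
  constructor
  · rintro ⟨y, hy, h⟩
    obtain ⟨n, hn, hm⟩ := (h.and (eventually_ge_atTop m)).exists
    exact ⟨n - m, y, hy, by rwa [Nat.add_sub_cancel' hm]⟩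
  · rintro ⟨j, y, hy, h⟩
    refine ⟨_, hC.mono (Nat.le_add_right m j) _ _ (fun i hi => ?_) hy, rel_splice h⟩
    simp [splice, hi]

theorem measurableSet_setOf_rel [∀ n, NeZero (k n)] {m : ℕ} {C : Set (Digits k)}
    (hC : IsLevel m C) (g : G) : MeasurableSet {x | ∃ y ∈ C, D.Rel g x y} := by
  rw [D.setOf_rel_eq hC]
  exact .iUnion fun j =>
    (D.isLevel_t (m + j) fun s => ∃ y ∈ C, D.t (m + j) y = s * g⁻¹).measurableSet

theorem measure_setOf_rel_le [∀ n, NeZero (k n)] {m : ℕ} {C : Set (Digits k)}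
    (hC : IsLevel m C) (g : G) :
    digitMeasure k {x | ∃ y ∈ C, D.Rel g x y} ≤ digitMeasure k C := by
  rw [D.setOf_rel_eq hC, Monotone.measure_iUnion]
  · exact iSup_le fun j => D.measure_shift_le (hC.mono (Nat.le_add_right m j)) g
  -- Copying the later digits from `x` carries the relation to the next level, so the union is
  -- increasing.
  · refine monotone_nat_of_le_succ fun j => ?_
    rintro x ⟨y, hy, h⟩
    refine ⟨splice (m + j) y x, hC.mono (Nat.le_add_right m j) _ _ (fun i hi => ?_) hy, ?_⟩
    · simp [splice, hi]
    · rw [← add_assoc, t_succ, t_succ, t_splice, h, mul_assoc]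
      simp [splice]

theorem measurableSet_domain [∀ n, NeZero (k n)] [Countable G] : MeasurableSet D.domain := by
  have : D.domain = ⋂ g, {x | ∃ y ∈ Set.univ, D.Rel g x y} := by
    ext x; simp [domain]
  rw [this]
  exact .iInter fun g => D.measurableSet_setOf_rel (m := 0) (fun _ _ _ _ => trivial) g

open Classical in
/-- The proportion of the elements of the `n`-th tile that leave it under right multiplication by
`g⁻¹`. -/
noncomputable def boundary (g : G) (n : ℕ) : ℝ≥0 :=
  ((D.T n).filter fun s => s * g⁻¹ ∉ D.T n).card / (D.T n).card

theorem boundary_eq [DecidableEq G] (g : G) (n : ℕ) : D.boundary g n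
    = ((D.T n).filter fun s => s * g⁻¹ ∉ D.T n).card / (D.T n).card := by
  rw [boundary]
  congr!

theorem measure_boundary [∀ n, NeZero (k n)] (g : G) (n : ℕ) :
    digitMeasure k {x | D.t n x * g⁻¹ ∉ D.T n} = D.boundary g n := by
  have h : ((D.T n).card : ℝ≥0) ≠ 0 := by exact_mod_cast (D.card_T_pos n).ne'
  rw [D.measure_t n fun s => s * g⁻¹ ∉ D.T n, boundary, ENNReal.coe_div h, div_eq_mul_inv]
  simp only [ENNReal.coe_natCast]
  congr!

/-- The tiles are asymptotically invariant under right multiplication. -/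
def IsFolner : Prop := ∀ g, Tendsto (D.boundary g) atTop (nhds 0)

variable {D}

/-- A point at which `g` does not act lies in the boundary set of every level, and these have
measures tending to 0. -/
theorem IsFolner.measure_compl_setOf_rel [∀ n, NeZero (k n)] (hD : D.IsFolner) (g : G) :
    digitMeasure k {x | ∃ y, D.Rel g x y}ᶜ = 0 := by
  refine le_antisymm ?_ zero_le
  refine ge_of_tendsto' (ENNReal.tendsto_coe.2 (hD g)) fun n => ?_
  rw [← D.measure_boundary]
  refine measure_mono fun x hx hn => hx ?_
  exact exists_rel_iff.2 ⟨n, hn⟩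

theorem IsFolner.measure_compl_domain [∀ n, NeZero (k n)] [Countable G] (hD : D.IsFolner) :
    digitMeasure k D.domainᶜ = 0 := by
  have : D.domainᶜ = ⋃ g, {x | ∃ y, D.Rel g x y}ᶜ := by
    ext x; simp [domain]
  rw [this]
  exact measure_iUnion_null hD.measure_compl_setOf_rel

/-- A set of full measure is non-empty, and any point at which `g` acts exhibits `g` as such a
quotient. Countability and finite generation both come from this. -/
theorem IsFolner.exists_eq_inv_mul [∀ n, NeZero (k n)] (hD : D.IsFolner) (g : G) :
    ∃ n, ∃ a ∈ D.T n, ∃ b ∈ D.T n, a⁻¹ * b = g := by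
  have : ({x | ∃ y, D.Rel g x y}).Nonempty := by
    rw [Set.nonempty_iff_ne_empty]
    intro h
    have := hD.measure_compl_setOf_rel g
    simp [h] at this
  obtain ⟨x, hx⟩ := this
  obtain ⟨n, hn⟩ := exists_rel_iff.1 hx
  exact ⟨n, _, hn, _, D.t_mem n x, by group⟩

theorem IsFolner.countable [∀ n, NeZero (k n)] (hD : D.IsFolner) : Countable G := by
  have h : (Set.univ : Set G) ⊆ ⋃ n, Set.image2 (fun a b => a⁻¹ * b) (D.T n) (D.T n) := by
    intro g _
    obtain ⟨n, a, ha, b, hb, h⟩ := hD.exists_eq_inv_mul g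
    exact Set.mem_iUnion.2 ⟨n, Set.mem_image2.2 ⟨a, ha, b, hb, h⟩⟩
  exact Set.countable_univ_iff.1 ((Set.countable_iUnion fun n =>
    ((D.T n).finite_toSet.image2 _ (D.T n).finite_toSet).countable).mono h)

theorem IsFolner.closure_eq_top [∀ n, NeZero (k n)] (hD : D.IsFolner) {S : Set G}
    (hS : ∀ n, ∀ g ∈ D.T n, g ∈ Subgroup.closure S) : Subgroup.closure S = ⊤ := by
  rw [eq_top_iff]
  rintro g -
  obtain ⟨n, a, ha, b, hb, rfl⟩ := hD.exists_eq_inv_mul g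
  exact mul_mem (inv_mem (hS n a ha)) (hS n b hb)

end Tiling

/-! ### The action and the coupling -/

/-- The set contains, with a sequence, all sequences that differ from it in finitely many digits. -/
def TailClosed {k : ℕ → ℕ} (Ω : Set (Digits k)) : Prop :=
  ∀ x ∈ Ω, ∀ y, (∀ᶠ n in atTop, y n = x n) → y ∈ Ω

namespace Tiling

variable {k : ℕ → ℕ} {G : Type*} [Group G] (D : Tiling k G) {Ω : Set (Digits k)}
  (hΩ : Ω ⊆ D.domain) (ht : TailClosed Ω)

/-- The image of a point under a group element. -/
noncomputable def shift (g : G) (x : Ω) : Ω :=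
  ⟨(hΩ x.2 g).choose, ht x x.2 _ (hΩ x.2 g).choose_spec.tail⟩

theorem rel_shift (g : G) (x : Ω) : D.Rel g x (D.shift hΩ ht g x) := (hΩ x.2 g).choose_spec

theorem shift_eq_iff {g : G} {x y : Ω} : D.shift hΩ ht g x = y ↔ D.Rel g x y :=
  ⟨fun h => h ▸ D.rel_shift hΩ ht g x, fun h => Subtype.ext ((D.rel_shift hΩ ht g x).unique h)⟩

/-- The action of the group on digit sequences defined by a tiling. -/
@[reducible]
noncomputable def action : MulAction G Ω where
  smul := D.shift hΩ ht
  one_smul _ := (D.shift_eq_iff hΩ ht).2 (Rel.one _)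
  mul_smul g h x := (D.shift_eq_iff hΩ ht).2
    ((D.rel_shift hΩ ht h x).comp (D.rel_shift hΩ ht g (D.shift hΩ ht h x)))

theorem measurePreserving_shift [∀ n, NeZero (k n)] (hm : MeasurableSet Ω)
    (h0 : digitMeasure k Ωᶜ = 0) (g : G) :
    MeasurePreserving (D.shift hΩ ht g) ((digitMeasure k).comap Subtype.val)
      ((digitMeasure k).comap Subtype.val) := by
  set μ := (digitMeasure k).comap (Subtype.val : Ω → Digits k) with hμ
  have hval (C : Set (Digits k)) : μ (Subtype.val ⁻¹' C) = digitMeasure k C := by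
    rw [hμ, comap_subtype_coe_apply hm, Subtype.image_preimage_coe, Set.inter_comm]
    exact measure_inter_conull h0
  have huniv : μ Set.univ = 1 := by
    rw [← Set.preimage_univ (f := Subtype.val), hval]
    exact measure_univ
  have hpre (C : Set (Digits k)) : D.shift hΩ ht g ⁻¹' (Subtype.val ⁻¹' C)
      = Subtype.val ⁻¹' {x | ∃ y ∈ C, D.Rel g x y} := by
    ext x
    simp only [Set.mem_preimage, Set.mem_ofPred_eq]
    exact ⟨fun h => ⟨_, h, D.rel_shift hΩ ht g x⟩,
      fun ⟨y, hy, h⟩ => (D.rel_shift hΩ ht g x).unique h ▸ hy⟩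
  have hgen : (Subtype.instMeasurableSpace : MeasurableSpace Ω) = MeasurableSpace.generateFrom
      (Set.preimage Subtype.val '' {C : Set (Digits k) | ∃ x n, C = PiNat.cylinder x n}) := by
    rw [← MeasurableSpace.comap_generateFrom,
      ← (PiNat.isTopologicalBasis_cylinders fun i => Fin (k i)).borel_eq_generateFrom,
      ← BorelSpace.measurable_eq]
    rfl
  have hmeas : Measurable (D.shift hΩ ht g) := by
    have h := @measurable_generateFrom Ω Ω Subtype.instMeasurableSpace
      (Set.preimage Subtype.val '' {C : Set (Digits k) | ∃ x n, C = PiNat.cylinder x n})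
      (D.shift hΩ ht g) (by
        rintro _ ⟨_, ⟨x, n, rfl⟩, rfl⟩
        rw [hpre]
        exact measurable_subtype_coe (D.measurableSet_setOf_rel (IsLevel.cylinder x n) g))
    rwa [← hgen] at h
  have : IsProbabilityMeasure μ := ⟨huniv⟩
  refine ⟨hmeas, ?_⟩
  have : IsProbabilityMeasure (μ.map (D.shift hΩ ht g)) :=
    Measure.isProbabilityMeasure_map hmeas.aemeasurable
  have hle {n : ℕ} {C : Set (Digits k)} (hC : IsLevel n C) :
      μ.map (D.shift hΩ ht g) (Subtype.val ⁻¹' C) ≤ μ (Subtype.val ⁻¹' C) := by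
    rw [Measure.map_apply hmeas (measurable_subtype_coe hC.measurableSet), hpre, hval, hval]
    exact D.measure_setOf_rel_le hC g
  refine ext_of_generate_finite _ hgen ?_ ?_ (by simp)
  · rintro _ ⟨_, ⟨x, n, rfl⟩, rfl⟩ _ ⟨_, ⟨y, m, rfl⟩, rfl⟩ ⟨z, hz, hz'⟩
    refine ⟨_, ⟨z, max n m, rfl⟩, ?_⟩
    rw [← Set.preimage_inter]
    congr 1
    ext w
    constructor
    · exact fun h => ⟨fun i hi => (h i (lt_max_of_lt_left hi)).trans (hz i hi),
        fun i hi => (h i (lt_max_of_lt_right hi)).trans (hz' i hi)⟩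
    · rintro ⟨h, h'⟩ i hi
      rcases lt_max_iff.1 hi with hi | hi
      · exact (h i hi).trans (hz i hi).symm
      · exact (h' i hi).trans (hz' i hi).symm
  · rintro _ ⟨_, ⟨x, n, rfl⟩, rfl⟩
    have hC := IsLevel.cylinder x n
    refine le_antisymm (hle hC) ?_
    -- Both measures are probabilities, so the inequality for the complement is the reverse
    -- inequality for the cylinder.
    have h1 := hle hC.compl
    rw [Set.preimage_compl, prob_compl_eq_one_sub (measurable_subtype_coe hC.measurableSet),
      prob_compl_eq_one_sub (measurable_subtype_coe hC.measurableSet)] at h1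
    exact (ENNReal.sub_le_sub_iff_left prob_le_one ENNReal.one_ne_top).1 h1

end Tiling

section Coupling

variable {k : ℕ → ℕ} {G K : Type*} [Group G] [Group K] {D : Tiling k G}
  {E : Tiling k K}

theorem tailClosed_domain (D : Tiling k G) (E : Tiling k K) :
    TailClosed (D.domain ∩ E.domain) :=
  fun _ hx _ h => ⟨Tiling.mem_domain_of_tail hx.1 h, Tiling.mem_domain_of_tail hx.2 h⟩

variable [∀ n, NeZero (k n)]

/-- The orbit equivalence coupling of two groups that have Følner tilings with the same numbers
of translates. -/
noncomputable def tilingCoupling (hD : D.IsFolner) (hE : E.IsFolner)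
    (hk : Tendsto (fun n => ∏ i ∈ Finset.range n, k i) atTop atTop) : OECoupling G K :=
  have : Countable G := hD.countable
  have : Countable K := hE.countable
  have hm : MeasurableSet (D.domain ∩ E.domain) :=
    D.measurableSet_domain.inter E.measurableSet_domain
  have h0 : digitMeasure k (D.domain ∩ E.domain)ᶜ = 0 := by
    rw [Set.compl_inter]
    exact measure_union_null hD.measure_compl_domain hE.measure_compl_domain
  have ht := tailClosed_domain D E
  letI := D.action Set.inter_subset_left ht
  letI := E.action Set.inter_subset_right ht
  { X := (D.domain ∩ E.domain : Set (Digits k))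
    standardBorel := hm.standardBorel
    μ := (digitMeasure k).comap Subtype.val
    isProbability := ⟨by
      rw [comap_subtype_coe_apply hm, Set.image_univ, Subtype.range_coe,
        ← Set.univ_inter (D.domain ∩ E.domain), measure_inter_conull h0, measure_univ]⟩
    noAtoms := fun x => by
      rw [comap_subtype_coe_apply hm, Set.image_singleton]
      refine le_antisymm ?_ zero_le
      have h1 : Tendsto (fun n => ((∏ i ∈ Finset.range n, k i : ℕ) : ℝ≥0∞)⁻¹) atTop (nhds 0) :=
        ENNReal.tendsto_inv_nat_nhds_zero.comp hk
      refine ge_of_tendsto' h1 fun n => ?_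
      rw [← digitMeasure_cylinder x.1 n]
      exact measure_mono (Set.singleton_subset_iff.2 (PiNat.self_mem_cylinder _ n))
    measurePreservingH := D.measurePreserving_shift Set.inter_subset_left ht hm h0
    measurePreservingK := E.measurePreserving_shift Set.inter_subset_right ht hm h0
    freeH := fun _ x h => ((D.shift_eq_iff Set.inter_subset_left ht).1 h).unique_group
      (Tiling.Rel.one x.1)
    freeK := fun _ x h => ((E.shift_eq_iff Set.inter_subset_right ht).1 h).unique_group
      (Tiling.Rel.one x.1)
    orbit_eq := ae_of_all _ fun x => by
      ext y
      constructor
      · rintro ⟨g, h⟩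
        obtain ⟨l, hl⟩ := Tiling.exists_rel_of_tail (D := E)
          ((D.shift_eq_iff Set.inter_subset_left ht).1 h).tail
        exact ⟨l, (E.shift_eq_iff Set.inter_subset_right ht).2 hl⟩
      · rintro ⟨g, h⟩
        obtain ⟨l, hl⟩ := Tiling.exists_rel_of_tail (D := D)
          ((E.shift_eq_iff Set.inter_subset_right ht).1 h).tail
        exact ⟨l, (D.shift_eq_iff Set.inter_subset_left ht).2 hl⟩ }

/-- Split according to the first level at which `g⁻¹` keeps the prefix of `x` in its tile. From that
level on the digits are unchanged, so `W` there bounds the cocycle. If the level is `n + 1`, then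
`x` was in the boundary at level `n`, whence the shift of index between the two factors. -/
theorem lintegral_le_of_rel (D : Tiling k G) (E : Tiling k K) {Ω : Set (Digits k)}
    (hm : MeasurableSet Ω) {g : G} {w : Ω → K} (hw : ∀ x : Ω, ∃ y, D.Rel g x y ∧ E.Rel (w x) x y)
    {S : Set K} {W : ℕ → ℝ≥0}
    (hW : ∀ n, ∀ a ∈ E.T n, ∀ b ∈ E.T n, (wordLength S (a⁻¹ * b) : ℝ≥0) ≤ W n)
    {φ : ℝ≥0 → ℝ≥0} (hφ : Monotone φ) (c : ℝ≥0) :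
    ∫⁻ x, (φ ((wordLength S (w x) : ℝ≥0) / c) : ℝ≥0∞) ∂(digitMeasure k).comap Subtype.val
      ≤ φ (W 0 / c) + ∑' n, (φ (W (n + 1) / c) : ℝ≥0∞) * D.boundary g n := by
  classical
  set B : ℕ → Set (Digits k) := fun n => {x | D.t n x * g⁻¹ ∉ D.T n} with hB
  have hBm (n : ℕ) : MeasurableSet (B n) := (D.isLevel_t n fun s => s * g⁻¹ ∉ D.T n).measurableSet
  have key (x : Ω) : (φ ((wordLength S (w x) : ℝ≥0) / c) : ℝ≥0∞)
      ≤ φ (W 0 / c) + ∑' n, (B n).indicator (fun _ => (φ (W (n + 1) / c) : ℝ≥0∞)) x := by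
    obtain ⟨y, hxy, hwx⟩ := hw x
    have hex := Tiling.exists_rel_iff.1 ⟨y, hxy⟩
    have hlen {n : ℕ} (hn : D.t n x * g⁻¹ ∈ D.T n) :
        (φ ((wordLength S (w x) : ℝ≥0) / c) : ℝ≥0∞) ≤ φ (W n / c) := by
      rw [hwx.eq_of_tail (hxy.tail_of_mem hn), ENNReal.coe_le_coe]
      refine hφ ?_
      gcongr
      exact hW n _ (E.t_mem n y) _ (E.t_mem n x)
    obtain ⟨n, hn, hmin⟩ : ∃ n, D.t n x * g⁻¹ ∈ D.T n ∧ ∀ m < n, D.t m x * g⁻¹ ∉ D.T m :=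
      ⟨Nat.find hex, Nat.find_spec hex, fun m => Nat.find_min hex⟩
    cases n with
    | zero => exact (hlen hn).trans le_self_add
    | succ m =>
      refine (hlen hn).trans (le_add_left ?_)
      refine le_trans ?_ (ENNReal.le_tsum m)
      rw [Set.indicator_of_mem (show x.1 ∈ B m from hmin m (Nat.lt_succ_self m))]
  have hle (f : Digits k → ℝ≥0∞) : ∫⁻ x : Ω, f x ∂(digitMeasure k).comap Subtype.val
      ≤ ∫⁻ x, f x ∂digitMeasure k := by
    rw [lintegral_subtype_comap hm]
    exact setLIntegral_le_lintegral _ _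
  refine (lintegral_mono key).trans ((hle fun x => φ (W 0 / c)
    + ∑' n, (B n).indicator (fun _ => (φ (W (n + 1) / c) : ℝ≥0∞)) x).trans ?_)
  rw [lintegral_add_left measurable_const, lintegral_const, measure_univ, mul_one,
    lintegral_tsum fun n => (measurable_const.indicator (hBm n)).aemeasurable]
  refine add_le_add_right (ENNReal.tsum_le_tsum fun n => ?_) _
  rw [lintegral_indicator_const (hBm n), hB, D.measure_boundary]

variable (hD : D.IsFolner) (hE : E.IsFolner)
  (hk : Tendsto (fun n => ∏ i ∈ Finset.range n, k i) atTop atTop)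

theorem lintegral_cocycleHK_le (g : G) {S : Set K} {W : ℕ → ℝ≥0}
    (hW : ∀ n, ∀ a ∈ E.T n, ∀ b ∈ E.T n, (wordLength S (a⁻¹ * b) : ℝ≥0) ≤ W n)
    {φ : ℝ≥0 → ℝ≥0} (hφ : Monotone φ) (c : ℝ≥0) :
    ∫⁻ x, (φ ((wordLength S ((tilingCoupling hD hE hk).cocycleHK g x) : ℝ≥0) / c) : ℝ≥0∞)
        ∂(tilingCoupling hD hE hk).μ
      ≤ φ (W 0 / c) + ∑' n, (φ (W (n + 1) / c) : ℝ≥0∞) * D.boundary g n := by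
  have : Countable G := hD.countable
  have : Countable K := hE.countable
  have ht := tailClosed_domain D E
  refine lintegral_le_of_rel D E (D.measurableSet_domain.inter E.measurableSet_domain)
    (fun x => ?_) hW hφ c
  have hx := D.rel_shift Set.inter_subset_left ht g x
  obtain ⟨l, hl⟩ := Tiling.exists_rel_of_tail (D := E) hx.tail
  have hex : ∃ l : K, l • (show (tilingCoupling hD hE hk).X from x)
      = g • (show (tilingCoupling hD hE hk).X from x) :=
    ⟨l, (E.shift_eq_iff Set.inter_subset_right ht (y := D.shift Set.inter_subset_left ht g x)).2 hl⟩
  refine ⟨_, hx, ?_⟩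
  have e : (tilingCoupling hD hE hk).cocycleHK g x = hex.choose := dif_pos hex
  exact e ▸ (E.shift_eq_iff Set.inter_subset_right ht).1 hex.choose_spec

theorem lintegral_cocycleKH_le (l : K) {S : Set G} {W : ℕ → ℝ≥0}
    (hW : ∀ n, ∀ a ∈ D.T n, ∀ b ∈ D.T n, (wordLength S (a⁻¹ * b) : ℝ≥0) ≤ W n)
    {φ : ℝ≥0 → ℝ≥0} (hφ : Monotone φ) (c : ℝ≥0) :
    ∫⁻ x, (φ ((wordLength S ((tilingCoupling hD hE hk).cocycleKH l x) : ℝ≥0) / c) : ℝ≥0∞)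
        ∂(tilingCoupling hD hE hk).μ
      ≤ φ (W 0 / c) + ∑' n, (φ (W (n + 1) / c) : ℝ≥0∞) * E.boundary l n := by
  have : Countable G := hD.countable
  have : Countable K := hE.countable
  have ht := tailClosed_domain D E
  refine lintegral_le_of_rel E D (D.measurableSet_domain.inter E.measurableSet_domain)
    (fun x => ?_) hW hφ c
  have hx := E.rel_shift Set.inter_subset_right ht l x
  obtain ⟨g, hg⟩ := Tiling.exists_rel_of_tail (D := D) hx.tail
  have hex : ∃ g : G, g • (show (tilingCoupling hD hE hk).X from x)
      = l • (show (tilingCoupling hD hE hk).X from x) :=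
    ⟨g, (D.shift_eq_iff Set.inter_subset_left ht (y := E.shift Set.inter_subset_right ht l x)).2 hg⟩
  refine ⟨_, hx, ?_⟩
  have e : (tilingCoupling hD hE hk).cocycleKH l x = hex.choose := dif_pos hex
  exact e ▸ (D.shift_eq_iff Set.inter_subset_left ht).1 hex.choose_spec

end Coupling

/-! ### Word length -/

/-- The element `g` is represented by a word of length at most `n` in `S ∪ S⁻¹`. -/
def WordLE {G : Type*} [Group G] (S : Set G) (n : ℕ) (g : G) : Prop :=
  ∃ l : List G, l.length ≤ n ∧ (∀ s ∈ l, s ∈ S ∨ s⁻¹ ∈ S) ∧ l.prod = g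

namespace WordLE

variable {G : Type*} [Group G] {S S₀ : Set G} {m n : ℕ} {g h : G}

theorem mono (hg : WordLE S m g) (hmn : m ≤ n) : WordLE S n g :=
  have ⟨l, hl, hS, hp⟩ := hg
  ⟨l, hl.trans hmn, hS, hp⟩

theorem one (n : ℕ) : WordLE S n 1 := ⟨[], by simp, by simp, rfl⟩

theorem of_mem (hg : g ∈ S) : WordLE S 1 g := ⟨[g], by simp, by simp [hg], by simp⟩

theorem mul (hg : WordLE S m g) (hh : WordLE S n h) : WordLE S (m + n) (g * h) := by
  obtain ⟨l, hl, hS, rfl⟩ := hg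
  obtain ⟨l', hl', hS', rfl⟩ := hh
  refine ⟨l ++ l', by simp; omega, fun s hs => ?_, by simp⟩
  rcases List.mem_append.1 hs with hs | hs
  · exact hS s hs
  · exact hS' s hs

theorem inv (hg : WordLE S n g) : WordLE S n g⁻¹ := by
  obtain ⟨l, hl, hS, rfl⟩ := hg
  refine ⟨(l.map fun a => a⁻¹).reverse, by simpa using hl, fun s hs => ?_,
    (List.prod_inv_reverse l).symm⟩
  simp only [List.mem_reverse, List.mem_map] at hs
  obtain ⟨a, ha, rfl⟩ := hs
  simpa using (hS a ha).symm

theorem pow (hg : WordLE S m g) (n : ℕ) : WordLE S (n * m) (g ^ n) := by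
  induction n with
  | zero => simpa using one 0
  | succ n ih => rw [pow_succ, Nat.succ_mul]; exact ih.mul hg

theorem prod {ι H : Type*} [CommGroup H] {S : Set H} (s : Finset ι) {c : ι → ℕ}
    {u : ι → H} (h : ∀ i ∈ s, WordLE S (c i) (u i)) :
    WordLE S (∑ i ∈ s, c i) (∏ i ∈ s, u i) := by
  classical
  induction s using Finset.induction_on with
  | empty => simpa using one 0
  | insert a s ha ih =>
    rw [Finset.sum_insert ha, Finset.prod_insert ha]
    exact (h a (Finset.mem_insert_self a s)).mul
      (ih fun i hi => h i (Finset.mem_insert_of_mem hi))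

theorem wordLength_le (hg : WordLE S n g) : wordLength S g ≤ n := by
  obtain ⟨l, hl, hS, hp⟩ := hg
  exact le_trans (Nat.sInf_le (show l.length ∈ _ from ⟨l, rfl, hS, hp⟩)) hl

theorem mem_closure (hg : WordLE S n g) : g ∈ Subgroup.closure S := by
  obtain ⟨l, _, hS, rfl⟩ := hg
  refine list_prod_mem fun s hs => ?_
  rcases hS s hs with h | h
  · exact Subgroup.subset_closure h
  · simpa using inv_mem (Subgroup.subset_closure h)

theorem exists_of_mem_closure (hg : g ∈ Subgroup.closure S) : ∃ n, WordLE S n g := by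
  induction hg using Subgroup.closure_induction with
  | mem x hx => exact ⟨1, of_mem hx⟩
  | one => exact ⟨0, one 0⟩
  | mul x y _ _ hx hy =>
    obtain ⟨m, hm⟩ := hx
    obtain ⟨n, hn⟩ := hy
    exact ⟨_, hm.mul hn⟩
  | inv x _ hx =>
    obtain ⟨n, hn⟩ := hx
    exact ⟨n, hn.inv⟩

/-- Change of generating set: `C` exceeds the `S`-length of every element of the finite set `S₀`. -/
theorem exists_of_finite (hS : Subgroup.closure S = ⊤) (h₀ : S₀.Finite) :
    ∃ C, 0 < C ∧ ∀ n g, WordLE S₀ n g → WordLE S (C * n) g := by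
  have hex (g : G) : ∃ n, WordLE S n g := exists_of_mem_closure (hS ▸ Subgroup.mem_top g)
  choose w hw using hex
  obtain ⟨C, hC⟩ := (h₀.image w).bddAbove
  refine ⟨C + 1, Nat.succ_pos C, ?_⟩
  rintro n g ⟨l, hl, hl₀, rfl⟩
  refine mono ?_ (Nat.mul_le_mul_left _ hl)
  clear hl
  induction l with
  | nil => simpa using one 0
  | cons a l ih =>
    rw [List.prod_cons, List.length_cons, Nat.mul_succ, add_comm]
    refine mul ?_ (ih fun s hs => hl₀ s (List.mem_cons_of_mem a hs))
    rcases hl₀ a List.mem_cons_self with h | h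
    · exact (hw a).mono ((hC ⟨a, h, rfl⟩).trans (Nat.le_succ C))
    · simpa using ((hw a⁻¹).mono ((hC ⟨_, h, rfl⟩).trans (Nat.le_succ C))).inv

end WordLE

/-! ### Box tilings of ℤ^d -/

/-- The side lengths of boxes in `ℤ^d`, the `n`-th step multiplying the side in the direction
`n % d` by `k n`. -/
def boxSide (d : ℕ) (k : ℕ → ℕ) : ℕ → Fin d → ℕ
  | 0, _ => 1
  | n + 1, j => if j.1 = n % d then boxSide d k n j * k n else boxSide d k n j

/-- The box with the given side lengths. -/
noncomputable def box {d : ℕ} (s : Fin d → ℕ) : Finset (FreeAb d) :=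
  (Fintype.piFinset fun j => Finset.Ico (0 : ℤ) (s j)).map Multiplicative.ofAdd.toEmbedding

theorem mem_box {d : ℕ} {s : Fin d → ℕ} {h : FreeAb d} :
    h ∈ box s ↔ ∀ j, 0 ≤ h.toAdd j ∧ h.toAdd j < s j := by
  simp only [box, Finset.mem_map_equiv, Fintype.mem_piFinset, Finset.mem_Ico]
  rfl

theorem card_box {d : ℕ} (s : Fin d → ℕ) : (box s).card = ∏ j, s j := by
  simp [box, Fintype.card_piFinset]

section

variable (d : ℕ) (k : ℕ → ℕ)

theorem boxSide_pos [∀ n, NeZero (k n)] (n : ℕ) (j : Fin d) : 0 < boxSide d k n j := by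
  induction n with
  | zero => exact Nat.one_pos
  | succ n ih =>
    rw [boxSide]
    split_ifs
    · exact Nat.mul_pos ih (NeZero.pos (k n))
    · exact ih

variable {k} in
theorem boxSide_mono [∀ n, NeZero (k n)] (j : Fin d) : Monotone fun n => boxSide d k n j := by
  refine monotone_nat_of_le_succ fun n => ?_
  rw [boxSide]
  split_ifs
  · exact Nat.le_mul_of_pos_right _ (NeZero.pos (k n))
  · exact le_rfl

theorem boxSide_eq_pow_count (n : ℕ) (j : Fin d) :
    boxSide d (fun _ => 2) n j = 2 ^ n.count (· ≡ j [MOD d]) := by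
  induction n with
  | zero => simp [boxSide]
  | succ n ih =>
    have : n ≡ j [MOD d] ↔ j.1 = n % d := by
      rw [Nat.ModEq, Nat.mod_eq_of_lt j.2, eq_comm]
    rw [boxSide, Nat.count_succ, ih]
    simp only [this]
    split_ifs <;> simp [pow_succ]

variable [NeZero d]

/-- The tiling of `ℤ^d` by boxes. -/
noncomputable def boxTiling [∀ n, NeZero (k n)] : Tiling k (FreeAb d) where
  f n i := Multiplicative.ofAdd
    (Pi.single (Fin.ofNat d n) ((i : ℤ) * boxSide d k n (Fin.ofNat d n)))
  T n := box (boxSide d k n)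
  T_zero := by
    ext h
    rw [mem_box, Finset.mem_singleton, ← toAdd_eq_zero, funext_iff]
    refine forall_congr' fun j => ?_
    simp only [boxSide, Nat.cast_one, Pi.zero_apply]
    omega
  mem_succ n g := by
    set e := Fin.ofNat d n with he
    have hev : e.1 = n % d := rfl
    have hs : (0 : ℤ) < boxSide d k n e := by exact_mod_cast boxSide_pos d k n e
    constructor
    · intro hg
      rw [mem_box] at hg
      have h1 := hg e
      simp only [boxSide, hev, if_true] at h1
      have hq0 : 0 ≤ g.toAdd e / (boxSide d k n e : ℤ) := Int.ediv_nonneg h1.1 hs.le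
      have hq1 : g.toAdd e / (boxSide d k n e : ℤ) < k n := by
        rw [Int.ediv_lt_iff_lt_mul hs, mul_comm]
        exact_mod_cast h1.2
      -- Euclidean division of the coordinate being extended: the quotient is the digit, the
      -- remainder lands in the smaller box.
      refine ⟨⟨(g.toAdd e / (boxSide d k n e : ℤ)).toNat, by omega⟩, Multiplicative.ofAdd
        (Function.update g.toAdd e (g.toAdd e % (boxSide d k n e : ℤ))), ?_, ?_⟩
      · rw [mem_box]
        intro j
        by_cases hj : j = e
        · subst hj
          simp only [toAdd_ofAdd, Function.update_self]
          exact ⟨Int.emod_nonneg _ hs.ne', Int.emod_lt_of_pos _ hs⟩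
        · have h2 := hg j
          have h3 : j.1 ≠ n % d := fun h => hj (Fin.ext h)
          simp only [boxSide, h3, if_false] at h2
          simpa [Function.update_of_ne hj] using h2
      · apply Multiplicative.toAdd.injective
        funext j
        simp only [toAdd_mul, toAdd_ofAdd, Pi.add_apply, Int.toNat_of_nonneg hq0]
        by_cases hj : j = e
        · subst hj
          simp only [Pi.single_eq_same, Function.update_self]
          exact Int.ediv_mul_add_emod _ _
        · simp [hj]
    · rintro ⟨i, s, hs', rfl⟩
      rw [mem_box] at hs' ⊢
      intro j
      have h2 := hs' j
      simp only [toAdd_mul, toAdd_ofAdd, Pi.add_apply, boxSide]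
      by_cases hj : j = e
      · subst hj
        rw [if_pos hev, Pi.single_eq_same]
        have hi : (i : ℤ) + 1 ≤ k n := by exact_mod_cast i.2
        push_cast
        constructor
        · nlinarith [h2.1, Int.natCast_nonneg i.1]
        · nlinarith [h2.2]
      · have h3 : j.1 ≠ n % d := fun h => hj (Fin.ext h)
        simpa [hj, h3] using h2
  inj n i j s hs s' hs' h := by
    rw [mem_box] at hs hs'
    have h1 := hs (Fin.ofNat d n)
    have h2 := hs' (Fin.ofNat d n)
    have h3 := congrFun (congrArg Multiplicative.toAdd h) (Fin.ofNat d n)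
    simp only [toAdd_mul, toAdd_ofAdd, Pi.add_apply, Pi.single_eq_same] at h3
    have h4 := congrArg (· / (boxSide d k n (Fin.ofNat d n) : ℤ)) h3
    have hne : (boxSide d k n (Fin.ofNat d n) : ℤ) ≠ 0 := by omega
    simp only [Int.add_ediv_of_dvd_left (Dvd.intro_left _ rfl),
      Int.mul_ediv_cancel _ hne, Int.ediv_eq_zero_of_lt h1.1 h1.2,
      Int.ediv_eq_zero_of_lt h2.1 h2.2] at h4
    exact Fin.ext (by omega)

theorem card_Ico_shift_le (m : ℕ) (z : ℤ) :
    ((Finset.Ico (0 : ℤ) m).filter fun a => ¬ (0 ≤ a - z ∧ a - z < m)).card ≤ z.natAbs := by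
  have : ((Finset.Ico (0 : ℤ) m).filter fun a => ¬ (0 ≤ a - z ∧ a - z < m)) ⊆
      if 0 ≤ z then Finset.Ico 0 z else Finset.Ico (m + z) m := by
    intro a ha
    rw [Finset.mem_filter, Finset.mem_Ico] at ha
    split_ifs <;> rw [Finset.mem_Ico] <;> omega
  refine (Finset.card_le_card this).trans ?_
  split_ifs <;> rw [Int.card_Ico] <;> omega

/-- A point that leaves the box leaves it in some coordinate `j`, which then takes at most |z_j|
values while the other coordinates are free. -/
theorem card_box_shift_le {d : ℕ} (s : Fin d → ℕ) (z : FreeAb d) :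
    ((box s).filter fun h => h * z⁻¹ ∉ box s).card
      ≤ ∑ j, (z.toAdd j).natAbs * ∏ l ∈ Finset.univ.erase j, s l := by
  set A : Fin d → Fin d → Finset ℤ := fun j => Function.update
    (fun l => Finset.Ico (0 : ℤ) (s l)) j ((Finset.Ico (0 : ℤ) (s j)).filter
      fun a => ¬ (0 ≤ a - z.toAdd j ∧ a - z.toAdd j < s j)) with hA
  have hsub : (box s).filter (fun h => h * z⁻¹ ∉ box s) ⊆ Finset.univ.biUnion fun j =>
      (Fintype.piFinset (A j)).map Multiplicative.ofAdd.toEmbedding := by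
    intro h hh
    rw [Finset.mem_filter, mem_box, mem_box, not_forall] at hh
    obtain ⟨h1, j, hj⟩ := hh
    refine Finset.mem_biUnion.2 ⟨j, Finset.mem_univ j, ?_⟩
    rw [Finset.mem_map_equiv, Fintype.mem_piFinset]
    intro l
    by_cases hl : l = j
    · subst hl
      simp only [hA]
      rw [Function.update_self, Finset.mem_filter, Finset.mem_Ico]
      refine ⟨h1 l, ?_⟩
      rwa [toAdd_mul, toAdd_inv, Pi.add_apply, Pi.neg_apply, ← sub_eq_add_neg] at hj
    · simp only [hA]
      rw [Function.update_of_ne hl, Finset.mem_Ico]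
      exact h1 l
  refine ((Finset.card_le_card hsub).trans Finset.card_biUnion_le).trans ?_
  refine Finset.sum_le_sum fun j _ => ?_
  rw [Finset.card_map, Fintype.card_piFinset, ← Finset.mul_prod_erase _ _ (Finset.mem_univ j)]
  refine Nat.mul_le_mul ?_ (Finset.prod_le_prod' fun l hl => ?_)
  · simp only [hA]
    rw [Function.update_self]
    exact card_Ico_shift_le (s j) (z.toAdd j)
  · simp only [hA]
    rw [Function.update_of_ne (Finset.ne_of_mem_erase hl), Int.card_Ico]
    simp

theorem boundary_boxTiling_le [∀ n, NeZero (k n)] (z : FreeAb d) (n : ℕ) :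
    (boxTiling d k).boundary z n ≤ ∑ j, (z.toAdd j).natAbs / (boxSide d k n j : ℝ≥0) := by
  have hpos (j : Fin d) : (0 : ℝ≥0) < boxSide d k n j := by exact_mod_cast boxSide_pos d k n j
  have hP : (0 : ℝ≥0) < ∏ j, (boxSide d k n j : ℝ≥0) := Finset.prod_pos fun j _ => hpos j
  have hT : (boxTiling d k).T n = box (boxSide d k n) := rfl
  rw [Tiling.boundary_eq, hT, card_box, Nat.cast_prod, div_le_iff₀ hP, Finset.sum_mul]
  refine (Nat.cast_le.2 (card_box_shift_le (boxSide d k n) z)).trans ?_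
  rw [Nat.cast_sum]
  refine Finset.sum_le_sum fun j _ => ?_
  rw [← Finset.mul_prod_erase _ (fun j => (boxSide d k n j : ℝ≥0)) (Finset.mem_univ j),
    ← mul_assoc, div_mul_cancel₀ _ (hpos j).ne', Nat.cast_mul, Nat.cast_prod]

/-- The standard generators of `ℤ^d`. -/
def stdGen {d : ℕ} (j : Fin d) : FreeAb d := Multiplicative.ofAdd (Pi.single j 1)

theorem wordLE_of_mem_box {d : ℕ} {s : Fin d → ℕ} {h : FreeAb d} (hh : h ∈ box s) :
    WordLE (Set.range (stdGen (d := d))) (∑ j, s j) h := by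
  rw [mem_box] at hh
  have : h = ∏ j, stdGen j ^ (h.toAdd j).toNat := by
    apply Multiplicative.toAdd.injective
    funext l
    rw [toAdd_prod, Finset.sum_apply, Finset.sum_eq_single l]
    · simp [stdGen, Int.toNat_of_nonneg (hh l).1]
    · intro b _ hb
      simp [stdGen, hb.symm]
    · simp
  rw [this]
  refine WordLE.mono (WordLE.prod _ fun j _ => (WordLE.of_mem (Set.mem_range_self j)).pow _) ?_
  refine Finset.sum_le_sum fun j _ => ?_
  have := (hh j).2
  omega

theorem boxSide_le (n : ℕ) (j : Fin d) : boxSide d (fun _ => 2) n j ≤ 2 ^ (n / d + 1) := by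
  rw [boxSide_eq_pow_count]
  refine Nat.pow_le_pow_right two_pos ?_
  rw [Nat.count_modEq_card _ (NeZero.pos d)]
  split_ifs <;> omega

theorem le_boxSide (n : ℕ) (j : Fin d) : 2 ^ (n / d) ≤ boxSide d (fun _ => 2) n j := by
  rw [boxSide_eq_pow_count]
  refine Nat.pow_le_pow_right two_pos ?_
  rw [Nat.count_modEq_card _ (NeZero.pos d)]
  omega

variable {k} in
-- Among `d` consecutive steps each direction is extended once, so its side acquires a factor `k m`
-- with `m ≥ n`.
theorem exists_le_boxSide [∀ n, NeZero (k n)] (n : ℕ) (j : Fin d) :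
    ∃ m, n ≤ m ∧ m < n + d ∧ k m ≤ boxSide d k (n + d) j := by
  obtain ⟨m, hm, hm', hj⟩ : ∃ m, n ≤ m ∧ m < n + d ∧ j.1 = m % d := by
    have hd := NeZero.pos d
    have hj := j.2
    have h1 := Nat.mod_lt n hd
    have h2 := Nat.div_add_mod n d
    rcases le_or_gt (n % d) j with h | h
    · exact ⟨d * (n / d) + j, by omega, by omega, by rw [Nat.mul_add_mod, Nat.mod_eq_of_lt hj]⟩
    · refine ⟨d * (n / d + 1) + j, by rw [Nat.mul_succ]; omega, by rw [Nat.mul_succ]; omega,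
        by rw [Nat.mul_add_mod, Nat.mod_eq_of_lt hj]⟩
  refine ⟨m, hm, hm', le_trans ?_ (boxSide_mono d j (Nat.succ_le_of_lt hm'))⟩
  simp only [boxSide, if_pos hj]
  exact Nat.le_mul_of_pos_left _ (boxSide_pos d k m j)

theorem prod_boxSide [∀ n, NeZero (k n)] (n : ℕ) :
    ∏ j, boxSide d k n j = ∏ i ∈ Finset.range n, k i := by
  rw [← (boxTiling d k).card_T n]
  exact (card_box _).symm

theorem sum_boxSide_le [∀ n, NeZero (k n)] (n : ℕ) :
    ∑ j, boxSide d k n j ≤ d * ∏ i ∈ Finset.range n, k i := by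
  rw [← prod_boxSide d]
  refine (Finset.sum_le_card_nsmul _ _ (∏ j, boxSide d k n j) fun j _ => ?_).trans_eq (by simp)
  exact Finset.single_le_prod' (fun i _ => boxSide_pos d k n i) (Finset.mem_univ j)

end

/-! ### Tilings of the lampjuggler -/

/-- The translates are indexed by the values of `rep n` on `T (n + 1)`, and `k n` is the number of
these values. Condition `h₃` lets every element recover the translate containing it, which gives
disjointness. -/
theorem exists_tiling_of_rep {G : Type*} [Group G] (T : ℕ → Finset G) (hT : T 0 = {1})
    (hne : ∀ n, (T n).Nonempty) (rep : ℕ → G → G)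
    (h₁ : ∀ n, ∀ g ∈ T (n + 1), (rep n g)⁻¹ * g ∈ T n)
    (h₂ : ∀ n, ∀ g ∈ T (n + 1), ∀ t ∈ T n, rep n g * t ∈ T (n + 1))
    (h₃ : ∀ n, ∀ g ∈ T (n + 1), ∀ t ∈ T n, rep n (rep n g * t) = rep n g) :
    ∃ k : ℕ → ℕ, (∀ n, NeZero (k n)) ∧ ∃ D : Tiling k G, D.T = T := by
  classical
  set F : ℕ → Finset G := fun n => (T (n + 1)).image (rep n) with hF
  have hmem {n : ℕ} (i : Fin (F n).card) : ∃ g ∈ T (n + 1), rep n g = (F n).equivFin.symm i :=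
    Finset.mem_image.1 ((F n).equivFin.symm i).2
  refine ⟨fun n => (F n).card, fun n => ⟨(Finset.card_pos.2 ((hne (n + 1)).image _)).ne'⟩,
    ⟨fun n i => (F n).equivFin.symm i, T, hT, fun n g => ⟨fun hg => ?_, ?_⟩, ?_⟩, rfl⟩
  · refine ⟨(F n).equivFin ⟨rep n g, Finset.mem_image_of_mem _ hg⟩, _, h₁ n g hg, ?_⟩
    simp
  · rintro ⟨i, t, ht, rfl⟩
    obtain ⟨g, hg, e⟩ := hmem i
    rw [← e]
    exact h₂ n g hg t ht
  · intro n i j t ht t' ht' h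
    obtain ⟨g, hg, e⟩ := hmem i
    obtain ⟨g', hg', e'⟩ := hmem j
    rw [← e, ← e'] at h
    have h4 := h₃ n g hg t ht
    rw [h, h₃ n g' hg' t' ht', e, e'] at h4
    exact (F n).equivFin.symm.injective (Subtype.ext h4.symm)

section

variable {H : Type*} (r : ℕ)

/-- The finitely supported permutations of `H × Fin r` whose support lies in `Z × Fin r`. -/
def lampSub (Z : Set H) : Subgroup (FSym (H × Fin r)) where
  carrier := {σ | ∀ y : H × Fin r, y.1 ∉ Z → σ.1 y = y}
  one_mem' := by simp
  mul_mem' := by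
    intro a b ha hb y hy
    simp [Equiv.Perm.mul_apply, hb y hy, ha y hy]
  inv_mem' := by
    intro a ha y hy
    exact Equiv.Perm.inv_eq_iff_eq.2 (ha y hy).symm

variable {r}

theorem lampSub_mono {Z Z' : Set H} (h : Z ⊆ Z') : lampSub r Z ≤ lampSub r Z' :=
  fun _ hσ y hy => hσ y fun hy' => hy (h hy')

/-- Permutations supported in `Z × Fin r` are the permutations of `Z × Fin r`. -/
noncomputable def lampSubEquiv {Z : Set H} (hZ : Z.Finite) :
    lampSub r Z ≃ Equiv.Perm {y : H × Fin r // y.1 ∈ Z} := by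
  classical
  refine Equiv.trans ⟨fun σ => ⟨σ.1.1, σ.2⟩, fun σ => ⟨⟨σ.1, ?_⟩, σ.2⟩, fun _ => rfl, fun _ => rfl⟩
    (Equiv.Perm.subtypeEquivSubtypePerm fun y : H × Fin r => y.1 ∈ Z).symm
  refine (hZ.prod (Set.finite_univ (α := Fin r))).subset fun y hy => ⟨?_, trivial⟩
  by_contra h
  exact hy (σ.2 y h)

instance (Z : Finset H) : Finite {y : H × Fin r // y.1 ∈ (Z : Set H)} :=
  ((Z.finite_toSet.prod (Set.finite_univ (α := Fin r))).subset
    fun _ hy => ⟨hy, trivial⟩ : {y : H × Fin r | y.1 ∈ (Z : Set H)}.Finite)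

theorem finite_lampSub (Z : Finset H) : (lampSub r (Z : Set H) : Set (FSym (H × Fin r))).Finite :=
  Finite.of_equiv _ (lampSubEquiv Z.finite_toSet).symm

/-- `lampSub` as a finite set. -/
noncomputable def lampFinset (r : ℕ) (Z : Finset H) : Finset (FSym (H × Fin r)) :=
  (finite_lampSub Z).toFinset

theorem mem_lampFinset {Z : Finset H} {σ : FSym (H × Fin r)} :
    σ ∈ lampFinset r Z ↔ σ ∈ lampSub r (Z : Set H) := by simp [lampFinset]

theorem card_lampFinset (Z : Finset H) : (lampFinset r Z).card = (Z.card * r).factorial := by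
  classical
  have e : {y : H × Fin r // y.1 ∈ (Z : Set H)} ≃ Z × Fin r :=
    ⟨fun y => (⟨y.1.1, y.2⟩, y.1.2), fun y => ⟨(y.1.1, y.2), y.1.2⟩, fun _ => rfl, fun _ => rfl⟩
  rw [lampFinset, ← Nat.card_eq_card_finite_toFinset]
  refine (Nat.card_congr (lampSubEquiv Z.finite_toSet)).trans ?_
  rw [Nat.card_perm, Nat.card_congr e]
  simp

variable [Group H]

theorem jugglerAction_apply (h : H) (σ : FSym (H × Fin r)) (y : H × Fin r) :
    (jugglerAction r H h σ).1 y = (h * (σ.1 (h⁻¹ * y.1, y.2)).1, (σ.1 (h⁻¹ * y.1, y.2)).2) := rfl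

theorem jugglerAction_mem_lampSub {h : H} {σ : FSym (H × Fin r)} {Z Z' : Set H}
    (hσ : σ ∈ lampSub r Z) (hZ : ∀ a ∈ Z, h * a ∈ Z') : jugglerAction r H h σ ∈ lampSub r Z' := by
  intro y hy
  rw [jugglerAction_apply, hσ]
  · simp
  · intro hy'
    exact hy (by simpa using hZ _ hy')

/-- The elements of the lampjuggler with position in `B` and with permutation supported in
`A × Fin r`. -/
noncomputable def lampTile (r : ℕ) (A B : Finset H) : Finset (Lampjuggler r H) :=
  (lampFinset r A ×ˢ B).map SemidirectProduct.equivProd.symm.toEmbedding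

theorem mem_lampTile {A B : Finset H} {g : Lampjuggler r H} :
    g ∈ lampTile r A B ↔ g.left ∈ lampSub r (A : Set H) ∧ g.right ∈ B := by
  rw [lampTile, Finset.mem_map_equiv, Finset.mem_product, mem_lampFinset]
  rfl

theorem card_lampTile (A B : Finset H) :
    (lampTile r A B).card = (A.card * r).factorial * B.card := by
  rw [lampTile, Finset.card_map, Finset.card_product, card_lampFinset]

/-- A representative of the left coset of `σ`. -/
noncomputable def cosetRep {P : Type*} [Group P] (S : Subgroup P) (σ : P) : P :=
  Quotient.out (σ : P ⧸ S)

theorem cosetRep_inv_mul_mem {P : Type*} [Group P] (S : Subgroup P) (σ : P) :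
    (cosetRep S σ)⁻¹ * σ ∈ S := QuotientGroup.eq.1 (Quotient.out_eq _)

theorem cosetRep_mul {P : Type*} [Group P] (S : Subgroup P) (σ : P) {s : P} (hs : s ∈ S) :
    cosetRep S (cosetRep S σ * s) = cosetRep S σ := by
  unfold cosetRep
  rw [QuotientGroup.mk_mul_of_mem _ hs, QuotientGroup.out_eq']

/-- The supports of the permutations in the tiles of the lampjuggler. -/
def lampSupport {m : ℕ → ℕ} (B : Tiling m H) (n : ℕ) : Finset H := if n = 0 then ∅ else B.T n

/-- One has (τ, f)(σ, h) = (τ (f · σ), f h). As σ runs over the permutations in the `n`-th tile, f ·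
σ runs over the subgroup `S n i` of those supported over the translate by f = `B.f n i`. So a
translate of the tile is given by the index `i` of the position and a left coset of `S n i`
containing the permutation. -/
theorem exists_lampTiling {m : ℕ → ℕ} [∀ n, NeZero (m n)] (B : Tiling m H) :
    ∃ k : ℕ → ℕ, (∀ n, NeZero (k n)) ∧ ∃ D : Tiling k (Lampjuggler r H),
      ∀ n, D.T n = lampTile r (lampSupport B n) (B.T n) := by
  have hstep (n : ℕ) (i : Fin (m n)) (a : H) (ha : a ∈ lampSupport B n) :
      B.f n i * a ∈ lampSupport B (n + 1) := by
    rw [lampSupport] at ha ⊢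
    split_ifs at ha with h
    · simp at ha
    · exact (B.mem_succ n _).2 ⟨i, a, ha, rfl⟩
  classical
  set idx : ∀ n, H → Fin (m n) := fun n h =>
    if e : ∃ i, ∃ t ∈ B.T n, B.f n i * t = h then e.choose else 0 with hidx
  have hidx₁ {n : ℕ} {h : H} (hh : h ∈ B.T (n + 1)) : (B.f n (idx n h))⁻¹ * h ∈ B.T n := by
    have e := (B.mem_succ n h).1 hh
    obtain ⟨t, ht, h1⟩ := e.choose_spec
    have h2 : idx n h = e.choose := dif_pos e
    rw [h2, ← eq_inv_mul_of_mul_eq h1]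
    exact ht
  have hidx₂ {n : ℕ} (i : Fin (m n)) {t : H} (ht : t ∈ B.T n) : idx n (B.f n i * t) = i := by
    refine B.inj n _ _ _ (hidx₁ ((B.mem_succ n _).2 ⟨i, t, ht, rfl⟩)) t ht ?_
    group
  set S : ∀ n, Fin (m n) → Subgroup (FSym (H × Fin r)) := fun n i =>
    lampSub r ((B.f n i * ·) '' (lampSupport B n : Set H)) with hS
  have hS_le (n : ℕ) (i : Fin (m n)) : S n i ≤ lampSub r (lampSupport B (n + 1) : Set H) := by
    refine lampSub_mono ?_
    rintro _ ⟨a, ha, rfl⟩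
    exact hstep n i a ha
  have hS_act {n : ℕ} (i : Fin (m n)) {σ : FSym (H × Fin r)}
      (hσ : σ ∈ lampSub r (lampSupport B n : Set H)) :
      jugglerAction r H (B.f n i) σ ∈ S n i :=
    jugglerAction_mem_lampSub hσ fun a ha => ⟨a, ha, rfl⟩
  suffices h : ∃ k : ℕ → ℕ, (∀ n, NeZero (k n)) ∧ ∃ D : Tiling k (Lampjuggler r H),
      D.T = fun n => lampTile r (lampSupport B n) (B.T n) by
    obtain ⟨k, hk, D, hD⟩ := h
    exact ⟨k, hk, D, fun n => congrFun hD n⟩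
  refine exists_tiling_of_rep _ ?_ ?_
    (fun n g => ⟨cosetRep (S n (idx n g.right)) g.left, B.f n (idx n g.right)⟩) ?_ ?_ ?_
  · ext g
    rw [mem_lampTile, B.T_zero, Finset.mem_singleton, Finset.mem_singleton]
    constructor
    · rintro ⟨h1, h2⟩
      refine SemidirectProduct.ext ?_ h2
      refine Subtype.ext (Equiv.ext fun y => h1 y ?_)
      -- The support at level 0 is empty; with `B.T 0` instead, the tile would contain all
      -- permutations of the `r` lamps over the identity.
      simp [lampSupport]
    · rintro rfl
      exact ⟨one_mem _, rfl⟩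
  · intro n
    obtain ⟨h, hh⟩ := Finset.card_pos.1 (B.card_T_pos n)
    exact ⟨⟨1, h⟩, mem_lampTile.2 ⟨one_mem _, hh⟩⟩
  · intro n g hg
    rw [mem_lampTile] at hg ⊢
    refine ⟨?_, hidx₁ hg.2⟩
    have h1 := cosetRep_inv_mul_mem (S n (idx n g.right)) g.left
    rw [SemidirectProduct.mul_left, SemidirectProduct.inv_left, SemidirectProduct.inv_right,
      ← map_mul]
    refine jugglerAction_mem_lampSub h1 ?_
    rintro _ ⟨a, ha, rfl⟩
    simpa using ha
  · intro n g hg t ht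
    rw [mem_lampTile] at hg ht ⊢
    refine ⟨?_, (B.mem_succ n _).2 ⟨_, _, ht.2, rfl⟩⟩
    rw [SemidirectProduct.mul_left]
    refine mul_mem ?_ (hS_le _ _ (hS_act _ ht.1))
    have h1 := hS_le _ _ (cosetRep_inv_mul_mem (S n (idx n g.right)) g.left)
    have h2 := mul_mem hg.1 (inv_mem h1)
    simpa using h2
  · intro n g hg t ht
    rw [mem_lampTile] at ht
    simp only [SemidirectProduct.mul_left, SemidirectProduct.mul_right, hidx₂ _ ht.2,
      cosetRep_mul _ _ (hS_act _ ht.1)]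

/-- Right multiplication of (σ, h) by `g⁻¹` moves h to h `g.right⁻¹` and alters σ only over the
points h y, with y below the support of `g⁻¹.left`. The tile is left only if one of these finitely
many translates of h leaves `B.T n`. The number of permutations is a common factor that cancels. -/
theorem exists_boundary_lampTiling_le {m k : ℕ → ℕ} [∀ n, NeZero (m n)] {B : Tiling m H}
    {D : Tiling k (Lampjuggler r H)} (hD : ∀ n, D.T n = lampTile r (lampSupport B n) (B.T n))
    (g : Lampjuggler r H) :
    ∃ P : Finset H, ∀ n, 1 ≤ n → D.boundary g n ≤ ∑ w ∈ P, B.boundary w n := by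
  classical
  have hfin : {y : H × Fin r | g⁻¹.left.1 y ≠ y}.Finite := g⁻¹.left.2
  refine ⟨insert g.right (hfin.toFinset.image fun y => y.1⁻¹), fun n hn => ?_⟩
  set P := insert g.right (hfin.toFinset.image fun y => y.1⁻¹) with hP
  have hsup : lampSupport B n = B.T n := if_neg (by omega)
  have hsub : ((D.T n).filter fun s => s * g⁻¹ ∉ D.T n) ⊆ P.biUnion fun w =>
      lampTile r (B.T n) ((B.T n).filter fun h => h * w⁻¹ ∉ B.T n) := by
    intro s hs
    rw [Finset.mem_filter, hD, hsup, mem_lampTile, mem_lampTile] at hs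
    obtain ⟨⟨h1, h2⟩, h3⟩ := hs
    rw [Finset.mem_biUnion]
    by_contra! hcon
    have h4 (w : H) (hw : w ∈ P) : s.right * w⁻¹ ∈ B.T n := by
      by_contra h
      exact hcon w hw (mem_lampTile.2 ⟨h1, Finset.mem_filter.2 ⟨h2, h⟩⟩)
    refine h3 ⟨?_, h4 _ (Finset.mem_insert_self _ _)⟩
    rw [SemidirectProduct.mul_left]
    refine mul_mem h1 (jugglerAction_mem_lampSub (Z := Prod.fst '' {y | g⁻¹.left.1 y ≠ y}) ?_ ?_)
    · intro y hy
      by_contra h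
      exact hy ⟨y, h, rfl⟩
    · rintro _ ⟨y, hy, rfl⟩
      have := h4 y.1⁻¹ (Finset.mem_insert_of_mem
        (Finset.mem_image_of_mem _ (hfin.mem_toFinset.2 hy)))
      simpa using this
  have hcard := (Finset.card_le_card hsub).trans Finset.card_biUnion_le
  simp only [card_lampTile, ← Finset.mul_sum] at hcard
  have hpos : (0 : ℝ≥0) < (((B.T n).card * r).factorial : ℝ≥0) := by
    exact_mod_cast Nat.factorial_pos _
  simp only [D.boundary_eq, B.boundary_eq]
  rw [← Finset.sum_div]
  conv_lhs => rw [show (D.T n).card = ((B.T n).card * r).factorial * (B.T n).card by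
    rw [hD, hsup, card_lampTile]]
  rw [Nat.cast_mul, ← div_div]
  gcongr
  rw [div_le_iff₀' hpos]
  exact_mod_cast hcard

end

/-! ### Word length in the lampjuggler -/

/-- A transposition as a finitely supported permutation. -/
def finSwap {Y : Type*} [DecidableEq Y] (a b : Y) : FSym Y :=
  ⟨Equiv.swap a b, Set.Finite.subset (Set.toFinite {a, b}) fun y hy => by
    by_contra h
    simp only [Set.mem_insert_iff, Set.mem_singleton_iff, not_or] at h
    exact hy (Equiv.swap_apply_of_ne_of_ne h.1 h.2)⟩

section

variable {r : ℕ} {H : Type*} [Group H] [DecidableEq H]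

/-- A transposition as an element of the lampjuggler. -/
def lampSwap (a b : H × Fin r) : Lampjuggler r H := SemidirectProduct.inl (finSwap a b)

theorem conj_lampSwap (g : Lampjuggler r H) (a b : H × Fin r) :
    g * lampSwap a b * g⁻¹ = lampSwap (g.left.1 (jugglerShift r g.right a))
      (g.left.1 (jugglerShift r g.right b)) := by
  refine SemidirectProduct.ext ?_ ?_
  · have h : g.left * jugglerAction r H g.right (finSwap a b) * g.left⁻¹ =
        finSwap (g.left.1 (jugglerShift r g.right a)) (g.left.1 (jugglerShift r g.right b)) := by
      refine Subtype.ext ?_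
      have := Equiv.swap_apply_apply (g.left.1 * jugglerShift r g.right) a b
      simp only [Equiv.Perm.mul_apply] at this
      simp only [finSwap, Subgroup.coe_mul, Subgroup.coe_inv, this, mul_inv_rev]
      simp only [jugglerAction, mul_assoc]
      rfl
    simpa [lampSwap, SemidirectProduct.mul_left, SemidirectProduct.inv_left] using h
  · simp [lampSwap]

/-- One transposition settles one point, so at most `A.card` of them are needed. -/
theorem wordLE_inl_of_swap {S : Set (Lampjuggler r H)} {c : ℕ} (A : Finset (H × Fin r))
    (hA : ∀ a ∈ A, ∀ b ∈ A, WordLE S c (lampSwap a b)) (σ : FSym (H × Fin r))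
    (hσ : ∀ y ∉ A, σ.1 y = y) : WordLE S (A.card * c) (SemidirectProduct.inl σ) := by
  induction A using Finset.induction_on generalizing σ with
  | empty =>
    have : σ = 1 := Subtype.ext (Equiv.ext fun y => hσ y (by simp))
    rw [this, map_one]
    exact WordLE.one _
  | insert a A ha ih =>
    rw [Finset.card_insert_of_notMem ha, Nat.succ_mul, add_comm]
    have hmem {y : H × Fin r} (hy : σ.1 y ≠ y) : σ.1 y ∈ insert a A := by
      by_contra h
      exact hy (σ.1.injective (hσ _ h))
    have haσ : σ.1 a ∈ insert a A := by
      by_cases h : σ.1 a = a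
      · rw [h]; exact Finset.mem_insert_self a A
      · exact hmem h
    have h1 : SemidirectProduct.inl σ = lampSwap a (σ.1 a) *
        (SemidirectProduct.inl (finSwap a (σ.1 a) * σ) : Lampjuggler r H) := by
      rw [lampSwap, ← map_mul, ← mul_assoc]
      congr 1
      refine Subtype.ext ?_
      simp [finSwap]
    rw [h1]
    refine (hA _ (Finset.mem_insert_self a A) _ haσ).mul (ih
      (fun x hx y hy => hA x (Finset.mem_insert_of_mem hx) y (Finset.mem_insert_of_mem hy)) _ ?_)
    intro y hy
    change Equiv.swap a (σ.1 a) (σ.1 y) = y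
    by_cases hya : y = a
    · rw [hya, Equiv.swap_apply_right]
    · have h2 : y ∉ insert a A := by simp [hya, hy]
      rw [hσ y h2]
      exact Equiv.swap_apply_of_ne_of_ne hya fun h => h2 (h ▸ haσ)

end

section

variable (r d : ℕ) [NeZero r]

/-- The base point of the lamps. -/
def lampOrigin : FreeAb d × Fin r := (1, 0)

/-- A finite generating set of the lampjuggler over `ℤ^d`. -/
def lampGen : Set (Lampjuggler r (FreeAb d)) :=
  Set.range (fun j => SemidirectProduct.inr (stdGen j)) ∪
    (Set.range (fun i => lampSwap (1, i) (lampOrigin r d)) ∪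
      Set.range fun p : Fin d × Fin r => lampSwap (stdGen p.1, p.2) (lampOrigin r d))

theorem finite_lampGen : (lampGen r d).Finite :=
  (Set.finite_range _).union ((Set.finite_range _).union (Set.finite_range _))

variable {r d}

theorem wordLE_lampSwap_origin (n : ℕ) (x : FreeAb d) (hx : ∀ j, 0 ≤ x.toAdd j)
    (hn : ∑ j, x.toAdd j = n) (i : Fin r) :
    WordLE (lampGen r d) (1 + 6 * n) (lampSwap (x, i) (lampOrigin r d)) := by
  induction n generalizing x with
  | zero =>
    have h1 : x = 1 := by
      apply Multiplicative.toAdd.injective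
      funext j
      exact (Finset.sum_eq_zero_iff_of_nonneg fun j _ => hx j).1 (by simpa using hn) j
        (Finset.mem_univ j)
    rw [h1]
    exact (WordLE.of_mem (S := lampGen r d) (Or.inr (Or.inl (Set.mem_range_self i)))).mono (by omega)
  | succ n ih =>
    obtain ⟨j, hj⟩ : ∃ j, 0 < x.toAdd j := by
      by_contra! h
      have := Finset.sum_nonpos fun j (_ : j ∈ Finset.univ) => h j
      omega
    by_cases hxj : x = stdGen j
    · rw [hxj]
      exact (WordLE.of_mem (S := lampGen r d) (Or.inr (Or.inr (Set.mem_range_self (j, i))))).mono (by omega)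
    -- The shift by `stdGen j` followed by this transposition brings the origin back to itself and
    -- moves the lamp one step closer to the origin onto `(x, i)`. Conjugation by `v` thus adds a
    -- bounded length per unit of distance.
    set v : Lampjuggler r (FreeAb d) :=
      lampSwap (stdGen j, 0) (lampOrigin r d) * SemidirectProduct.inr (stdGen j) with hv
    have hvw : WordLE (lampGen r d) 2 v :=
      (WordLE.of_mem (S := lampGen r d) (Or.inr (Or.inr (Set.mem_range_self (j, 0))))).mul
        (WordLE.of_mem (S := lampGen r d) (Or.inl (Set.mem_range_self j)))
    have hle : Multiplicative.toAdd (stdGen j) ≤ x.toAdd := by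
      intro l
      by_cases hl : l = j
      · subst hl
        simpa [stdGen] using Int.add_one_le_of_lt hj
      · simpa [stdGen, hl] using hx l
    have h1 := ih (x * (stdGen j)⁻¹) (fun l => by
        have : (stdGen j).toAdd l ≤ x.toAdd l := hle l
        simp only [toAdd_mul, toAdd_inv, Pi.add_apply, Pi.neg_apply]
        omega) (by
      simp only [toAdd_mul, toAdd_inv, Pi.add_apply, Pi.neg_apply, Finset.sum_add_distrib, hn,
        Finset.sum_neg_distrib]
      simp [stdGen])
    have h2 := (hvw.mul h1).mul hvw.inv
    rw [conj_lampSwap] at h2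
    have hvr : v.right = stdGen j := by simp [hv, lampSwap]
    have hvl : v.left.1 = Equiv.swap (stdGen j, 0) (lampOrigin r d) := by
      simp [hv, lampSwap, finSwap]
    have e1 : v.left.1 (jugglerShift r v.right (lampOrigin r d)) = lampOrigin r d := by
      rw [hvr, hvl]
      have : jugglerShift r (stdGen j) (lampOrigin r d) = (stdGen j, 0) := by
        simp [jugglerShift, lampOrigin]
      rw [this, Equiv.swap_apply_left]
    have e2 : v.left.1 (jugglerShift r v.right (x * (stdGen j)⁻¹, i)) = (x, i) := by
      rw [hvr, hvl]
      have : jugglerShift r (stdGen j) (x * (stdGen j)⁻¹, i) = (x, i) := by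
        simp [jugglerShift]
      rw [this]
      refine Equiv.swap_apply_of_ne_of_ne (fun h => hxj (congrArg Prod.fst h)) fun h => ?_
      have h3 : x = 1 := congrArg Prod.fst h
      rw [h3] at hj
      simp at hj
    rw [e1, e2] at h2
    exact h2.mono (by omega)

/-- Generically, conjugating the transposition of `b` and the origin by that of `a` and the origin
gives the transposition of `b` and `a`; coincidences among the three points are treated apart. -/
theorem wordLE_lampSwap {s : Fin d → ℕ} {a b : FreeAb d × Fin r} (ha : a.1 ∈ box s)
    (hb : b.1 ∈ box s) : WordLE (lampGen r d) (3 * (1 + 6 * ∑ j, s j)) (lampSwap a b) := by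
  have key {a : FreeAb d × Fin r} (ha : a.1 ∈ box s) :
      WordLE (lampGen r d) (1 + 6 * ∑ j, s j) (lampSwap a (lampOrigin r d)) := by
    rw [mem_box] at ha
    have h0 : 0 ≤ ∑ j, a.1.toAdd j := Finset.sum_nonneg fun j _ => (ha j).1
    have h1 : ∑ j, a.1.toAdd j ≤ ∑ j, (s j : ℤ) := Finset.sum_le_sum fun j _ => (ha j).2.le
    have h2 : (∑ j, a.1.toAdd j).toNat ≤ ∑ j, s j := by
      zify
      omega
    exact (wordLE_lampSwap_origin _ a.1 (fun j => (ha j).1) (Int.toNat_of_nonneg h0).symm a.2).mono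
      (by omega)
  by_cases hao : a = lampOrigin r d
  · subst hao
    have : lampSwap (lampOrigin r d) b = lampSwap b (lampOrigin r d) := by
      simp only [lampSwap, finSwap, Equiv.swap_comm]
    rw [this]
    exact (key hb).mono (by omega)
  by_cases hab : b = a
  · subst hab
    have : lampSwap b b = 1 := by
      rw [lampSwap, ← map_one SemidirectProduct.inl]
      congr 1
      exact Subtype.ext (Equiv.swap_self _)
    rw [this]
    exact WordLE.one _
  have h := ((key ha).mul (key hb)).mul (key ha).inv
  rw [conj_lampSwap] at h
  have hl : (lampSwap a (lampOrigin r d)).left.1 = Equiv.swap a (lampOrigin r d) := rfl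
  have hr : (lampSwap a (lampOrigin r d)).right = 1 := rfl
  rw [hr, jugglerShift_one, hl, Equiv.Perm.one_apply, Equiv.Perm.one_apply,
    Equiv.swap_apply_right] at h
  by_cases hbo : b = lampOrigin r d
  · rw [hbo]
    exact (key ha).mono (by omega)
  rw [Equiv.swap_apply_of_ne_of_ne hab hbo] at h
  have : lampSwap b a = lampSwap a b := by
    simp only [lampSwap, finSwap, Equiv.swap_comm]
  rw [← this]
  exact h.mono (by omega)

theorem wordLE_of_mem_lampTile {s : Fin d → ℕ} {A : Finset (FreeAb d)} (hA : A ⊆ box s)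
    {g : Lampjuggler r (FreeAb d)} (hg : g ∈ lampTile r A (box s)) :
    WordLE (lampGen r d) ((∏ j, s j) * r * (3 * (1 + 6 * ∑ j, s j)) + ∑ j, s j) g := by
  rw [mem_lampTile] at hg
  rw [← SemidirectProduct.inl_left_mul_inr_right g]
  refine WordLE.mul ?_ ?_
  · have := wordLE_inl_of_swap (S := lampGen r d) (box s ×ˢ (Finset.univ : Finset (Fin r)))
      (fun a ha b hb => wordLE_lampSwap (Finset.mem_product.1 ha).1 (Finset.mem_product.1 hb).1)
      g.left fun y hy => hg.1 y fun hyA => hy (Finset.mem_product.2 ⟨hA hyA, Finset.mem_univ _⟩)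
    rwa [Finset.card_product, card_box, Finset.card_univ, Fintype.card_fin] at this
  · obtain ⟨l, hl, hS, hp⟩ := wordLE_of_mem_box hg.2
    refine ⟨l.map SemidirectProduct.inr, by simpa using hl, fun x hx => ?_, ?_⟩
    · obtain ⟨a, ha, rfl⟩ := List.mem_map.1 hx
      rcases hS a ha with ⟨j, rfl⟩ | ⟨j, hj⟩
      · exact Or.inl (Or.inl ⟨j, rfl⟩)
      · exact Or.inr (Or.inl ⟨j, by simp [hj]⟩)
    · rw [← hp, map_list_prod]

end

/-! ### Numerical estimates -/

theorem factorial_mul_pow_le {r : ℕ} {n : ℕ} (hn : 1 ≤ n) :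
    (2 ^ (n + 1) * r).factorial * 2 ^ (n + 1) ≤ 2 ^ ((2 * r * (2 + r) + 2) * n * 2 ^ n) := by
  have h1 : (2 ^ (n + 1) * r).factorial ≤ 2 ^ ((n + 1 + r) * (2 ^ (n + 1) * r)) := by
    refine (Nat.factorial_le_pow _).trans ?_
    rw [pow_mul 2 (n + 1 + r)]
    refine Nat.pow_le_pow_left ?_ _
    rw [pow_add 2 (n + 1) r]
    exact Nat.mul_le_mul_left _ Nat.lt_two_pow_self.le
  refine (Nat.mul_le_mul_right _ h1).trans ?_
  rw [← pow_add]
  refine Nat.pow_le_pow_right two_pos ?_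
  have h2 : 1 ≤ 2 ^ n := Nat.one_le_two_pow
  have h3 : n + 1 + r ≤ n * (2 + r) := by nlinarith
  calc (n + 1 + r) * (2 ^ (n + 1) * r) + (n + 1)
      ≤ n * (2 + r) * (2 ^ (n + 1) * r) + 2 * n * 2 ^ n := by
        gcongr
        nlinarith
    _ = _ := by ring

/-- With N = 2^n r, `k n` is 2 (2N)!/N!, and (2N)!/N! is at least (N + 1)^N. -/
theorem two_pow_le_of_prod_eq {k : ℕ → ℕ} {r : ℕ} (hr : 1 ≤ r)
    (hQ : ∀ n, 1 ≤ n → ∏ i ∈ Finset.range n, k i = (2 ^ n * r).factorial * 2 ^ n)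
    {n : ℕ} (hn : 1 ≤ n) : 2 ^ (n * 2 ^ n) ≤ k n := by
  have h1 := hQ (n + 1) (by omega)
  rw [Finset.prod_range_succ, hQ n hn] at h1
  have h2 := Nat.factorial_mul_pow_le_factorial (m := 2 ^ n * r) (n := 2 ^ n * r)
  have h3 : 2 ^ n * r + 2 ^ n * r = 2 ^ (n + 1) * r := by ring
  rw [h3] at h2
  have h4 : 2 ^ (n * 2 ^ n) ≤ (2 ^ n * r + 1) ^ (2 ^ n * r) := by
    rw [pow_mul]
    exact (Nat.pow_le_pow_left (by nlinarith [Nat.one_le_two_pow (n := n)]) _).trans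
      (Nat.pow_le_pow_right (by omega) (Nat.le_mul_of_pos_right _ hr))
  have h5 : 0 < (2 ^ n * r).factorial * 2 ^ n := by positivity
  refine Nat.le_of_mul_le_mul_left ?_ h5
  rw [h1]
  calc (2 ^ n * r).factorial * 2 ^ n * 2 ^ (n * 2 ^ n)
      ≤ (2 ^ n * r).factorial * 2 ^ n * (2 ^ n * r + 1) ^ (2 ^ n * r) := by gcongr
    _ = (2 ^ n * r).factorial * (2 ^ n * r + 1) ^ (2 ^ n * r) * 2 ^ n := by ring
    _ ≤ (2 ^ (n + 1) * r).factorial * 2 ^ (n + 1) := by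
        refine Nat.mul_le_mul h2 (Nat.pow_le_pow_right two_pos (by omega))

/-- At `X n` the logarithm is of order n 2^n and the iterated logarithm is at least n log 2. The
factor 2^(n/d) cancels against `b n`, leaving the exponent 1/d - (1 + 1/d + ε) = -(1 + ε) of n. -/
theorem summable_log_profile {d : ℕ} (hd : 1 ≤ d) {ε : ℝ} (hε : 0 < ε) {φ : ℝ≥0 → ℝ≥0}
    (hφm : Monotone φ) (hφ : ∀ᶠ x : ℝ≥0 in atTop, (φ x : ℝ) =
      Real.log x ^ (1 / (d : ℝ)) / Real.log (Real.log x) ^ (1 + 1 / (d : ℝ) + ε))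
    {A : ℕ} (hA : 2 ≤ A) {Q : ℕ → ℝ≥0} (hQ : ∀ n, 1 ≤ n → Q (n + 1) ≤ 2 ^ (A * n * 2 ^ n))
    {C : ℝ} {b : ℕ → ℝ≥0} (hb : ∀ n, 1 ≤ n → (b n : ℝ) ≤ C * 2 ^ (-((n : ℝ) / d))) :
    Summable fun n => φ (Q (n + 1)) * b n := by
  set X : ℕ → ℝ≥0 := fun n => 2 ^ (A * n * 2 ^ n) with hX
  have hXt : Tendsto X atTop atTop := by
    refine tendsto_atTop_mono' atTop ?_ (tendsto_natCast_atTop_atTop (R := ℝ≥0))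
    filter_upwards with n
    have h1 : n < 2 ^ n := Nat.lt_two_pow_self
    have h2 : n ≤ A * n * 2 ^ n :=
      (Nat.le_mul_of_pos_left n (by omega)).trans (Nat.le_mul_of_pos_right _ (by positivity))
    have h3 : (2 : ℕ) ^ n ≤ 2 ^ (A * n * 2 ^ n) := Nat.pow_le_pow_right two_pos h2
    change (n : ℝ≥0) ≤ 2 ^ (A * n * 2 ^ n)
    exact_mod_cast h1.le.trans h3
  have hl2 : 0 < Real.log 2 := Real.log_pos one_lt_two
  have hl2' : 1 ≤ A * Real.log 2 := by
    have h1 : (2 : ℝ) ≤ A := by exact_mod_cast hA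
    nlinarith [Real.log_two_gt_d9]
  set p := 1 + 1 / (d : ℝ) + ε with hp
  have hd0 : (0 : ℝ) < d := by exact_mod_cast hd
  have hp0 : 0 ≤ p := by positivity
  have hsum : Summable fun n : ℕ => (A * Real.log 2) ^ (1 / (d : ℝ)) / Real.log 2 ^ p * C
      * (n : ℝ) ^ (-(1 + ε)) :=
    (Real.summable_nat_rpow.2 (by linarith)).mul_left _
  rw [← NNReal.summable_coe]
  refine Summable.of_norm_bounded_eventually_nat hsum ?_
  filter_upwards [hXt.eventually hφ, eventually_ge_atTop 1] with n hn h1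
  have hn0 : (0 : ℝ) < n := by exact_mod_cast h1
  rw [NNReal.norm_eq, NNReal.coe_mul]
  have hφX : (φ (Q (n + 1)) : ℝ) ≤ φ (X n) := NNReal.coe_le_coe.2 (hφm (hQ n h1))
  have hlog : Real.log (X n) = A * Real.log 2 * (n * 2 ^ n) := by
    rw [hX]
    push_cast
    rw [Real.log_pow]
    push_cast
    ring
  have hpos2 : (0 : ℝ) < n * 2 ^ n := by positivity
  have hloglog : n * Real.log 2 ≤ Real.log (Real.log (X n)) := by
    rw [← Real.log_pow]
    refine Real.log_le_log (by positivity) ?_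
    rw [hlog]
    have : (1 : ℝ) ≤ n := by exact_mod_cast h1
    have h2n : (0 : ℝ) < 2 ^ n := by positivity
    calc (2 : ℝ) ^ n ≤ n * 2 ^ n := le_mul_of_one_le_left h2n.le this
      _ ≤ _ := le_mul_of_one_le_left hpos2.le hl2'
  have hφX' : (φ (X n) : ℝ) ≤ (A * Real.log 2) ^ (1 / (d : ℝ)) * (n ^ (1 / (d : ℝ))
      * 2 ^ ((n : ℝ) / d)) / (n ^ p * Real.log 2 ^ p) := by
    rw [hn, hlog, Real.mul_rpow (by positivity) hpos2.le, Real.mul_rpow hn0.le (by positivity),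
      ← Real.rpow_natCast 2 n, ← Real.rpow_mul two_pos.le, mul_one_div,
      ← Real.mul_rpow hn0.le hl2.le]
    rw [hlog, ← Real.rpow_natCast 2 n] at hloglog
    gcongr
  calc (φ (Q (n + 1)) : ℝ) * b n
      ≤ (A * Real.log 2) ^ (1 / (d : ℝ)) * (n ^ (1 / (d : ℝ)) * 2 ^ ((n : ℝ) / d))
        / (n ^ p * Real.log 2 ^ p) * (C * 2 ^ (-((n : ℝ) / d))) :=
        mul_le_mul (hφX.trans hφX') (hb n h1) (b n).2 (by positivity)
    _ = (A * Real.log 2) ^ (1 / (d : ℝ)) / Real.log 2 ^ p * C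
        * (n ^ (1 / (d : ℝ)) / n ^ p) * (2 ^ ((n : ℝ) / d) * 2 ^ (-((n : ℝ) / d))) := by
        field_simp
    _ = _ := by
        rw [← Real.rpow_add two_pos, add_neg_cancel, Real.rpow_zero, mul_one,
          ← Real.rpow_sub hn0, hp]
        congr 2
        ring

/-- At the n-th argument y the exponent y^q, with q = d/(d+1), equals η 2^n, while y ≤ 4^n; so ψ(y)
is at most 2^(2nη 2^n). A small η makes this negligible against the decay of `b`. -/
theorem exists_summable_exp_profile {d : ℕ} (hd : 1 ≤ d) {ψ : ℝ≥0 → ℝ≥0}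
    (hψ : ∀ᶠ x : ℝ≥0 in atTop, (ψ x : ℝ) = (x : ℝ) ^ ((x : ℝ) ^ ((d : ℝ) / ((d : ℝ) + 1))))
    {e : ℕ} {Z : ℝ} {b : ℕ → ℝ≥0}
    (hb : ∀ n, 1 ≤ n → (b (n + e) : ℝ) ≤ Z / 2 ^ (n * 2 ^ n)) :
    ∃ δ : ℝ≥0, 0 < δ ∧
      Summable fun n : ℕ => ψ (δ * 2 ^ ((n : ℝ) * (1 + 1 / (d : ℝ)))) * b n := by
  have hd0 : (0 : ℝ) < d := by exact_mod_cast hd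
  have hd1 : (1 : ℝ) ≤ d := by exact_mod_cast hd
  set q : ℝ := d / (d + 1) with hq
  have hq0 : 0 < q := by positivity
  have hqd : (1 + 1 / (d : ℝ)) * q = 1 := by rw [hq]; field_simp
  -- The power 2^e offsets the delay `e` in the decay of `b`. The factor 8 makes the bound on ψ the
  -- square root of the denominator bounding `b`, so a power is left for summation.
  set η : ℝ≥0 := (2 ^ (e + 3))⁻¹ with hη
  have hη0 : 0 < η := by positivity
  have hη1 : η ≤ 1 := inv_le_one_of_one_le₀ (one_le_pow₀ one_le_two)
  refine ⟨η ^ (1 / q), NNReal.rpow_pos hη0, ?_⟩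
  set y : ℕ → ℝ≥0 := fun n => η ^ (1 / q) * 2 ^ ((n : ℝ) * (1 + 1 / (d : ℝ))) with hy
  have hyt : Tendsto y atTop atTop := by
    refine Tendsto.const_mul_atTop (NNReal.rpow_pos hη0) ?_
    refine tendsto_atTop_mono (fun n => ?_) (tendsto_natCast_atTop_atTop (R := ℝ≥0))
    have h1 : (n : ℝ≥0) ≤ 2 ^ n := by exact_mod_cast Nat.lt_two_pow_self.le
    refine h1.trans ?_
    rw [← NNReal.rpow_natCast]
    refine NNReal.rpow_le_rpow_of_exponent_le one_le_two ?_
    exact le_mul_of_one_le_right (Nat.cast_nonneg n) (by simp)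
  have hyq (n : ℕ) : (y n : ℝ) ^ q = η * 2 ^ n := by
    rw [hy, NNReal.coe_mul, NNReal.coe_rpow, NNReal.coe_rpow, NNReal.coe_ofNat,
      Real.mul_rpow (by positivity) (by positivity), ← Real.rpow_mul η.coe_nonneg,
      ← Real.rpow_mul two_pos.le, mul_assoc, hqd, one_div_mul_cancel hq0.ne', Real.rpow_one,
      mul_one, Real.rpow_natCast]
  have hy2 (n : ℕ) : (y n : ℝ) ≤ 2 ^ (2 * n) := by
    have h1 : (η ^ (1 / q) : ℝ≥0) ≤ 1 := NNReal.rpow_le_one hη1 (by positivity)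
    have h2 : (2 : ℝ) ^ ((n : ℝ) * (1 + 1 / (d : ℝ))) ≤ 2 ^ (2 * n) := by
      rw [← Real.rpow_natCast]
      refine Real.rpow_le_rpow_of_exponent_le one_le_two ?_
      push_cast
      have h3 : 1 / (d : ℝ) ≤ 1 := by rw [div_le_one hd0]; exact hd1
      nlinarith [Nat.cast_nonneg (α := ℝ) n]
    rw [hy, NNReal.coe_mul, NNReal.coe_rpow 2, NNReal.coe_ofNat]
    calc _ ≤ 1 * (2 : ℝ) ^ ((n : ℝ) * (1 + 1 / (d : ℝ))) := by gcongr; exact_mod_cast h1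
      _ ≤ _ := by rwa [one_mul]
  rw [← NNReal.summable_coe, ← summable_nat_add_iff e]
  have hsum : Summable fun n : ℕ => Z * (1 / 2 : ℝ) ^ n := summable_geometric_two.mul_left Z
  refine Summable.of_norm_bounded_eventually_nat hsum ?_
  filter_upwards [(tendsto_add_atTop_nat e).eventually (hyt.eventually hψ),
    eventually_ge_atTop (e + 1)] with n hn hne
  rw [NNReal.norm_eq, NNReal.coe_mul]
  change (ψ (y (n + e)) : ℝ) * _ ≤ _
  obtain ⟨n, rfl⟩ : ∃ m, n = m + 1 := ⟨n - 1, by omega⟩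
  have hexp : (η : ℝ) * 2 ^ (n + 1 + e) = 2 ^ n / 4 := by
    rw [hη]
    push_cast
    rw [pow_add, pow_add, pow_add]
    field_simp
    norm_num
  have h1 : (ψ (y (n + 1 + e)) : ℝ) ≤ 2 ^ ((n + 1) * 2 ^ n) := by
    rw [hn, hyq, hexp]
    refine (Real.rpow_le_rpow (y _).2 (hy2 _) (by positivity)).trans ?_
    rw [← Real.rpow_natCast 2 (2 * _), ← Real.rpow_mul two_pos.le,
      ← Real.rpow_natCast 2 ((n + 1) * 2 ^ n)]
    refine Real.rpow_le_rpow_of_exponent_le one_le_two ?_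
    push_cast
    have h2 : (e : ℝ) ≤ n := by exact_mod_cast (by omega : e ≤ n)
    have h3 : (0 : ℝ) < 2 ^ n := by positivity
    nlinarith
  have hb' := hb (n + 1) (by omega)
  have hZ : 0 ≤ Z := by
    have := (b (n + 1 + e)).2.trans hb'
    by_contra! hneg
    exact absurd this (not_le.2 (div_neg_of_neg_of_pos hneg (by positivity)))
  calc (ψ (y (n + 1 + e)) : ℝ) * b (n + 1 + e)
      ≤ 2 ^ ((n + 1) * 2 ^ n) * (Z / 2 ^ ((n + 1) * 2 ^ (n + 1))) :=
        mul_le_mul h1 hb' (b _).2 (by positivity)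
    _ = Z / 2 ^ ((n + 1) * 2 ^ n) := by
        rw [show (n + 1) * 2 ^ (n + 1) = (n + 1) * 2 ^ n + (n + 1) * 2 ^ n by ring, pow_add]
        field_simp
    _ ≤ Z / 2 ^ (n + 1) := by
        gcongr
        · exact one_le_two
        · exact Nat.le_mul_of_pos_right _ (by positivity)
    _ = _ := by rw [one_div, inv_pow, div_eq_mul_inv]

theorem coe_add_tsum_lt_top (a : ℝ≥0) {u v : ℕ → ℝ≥0} (h : Summable fun n => u n * v n) :
    (a : ℝ≥0∞) + ∑' n, (u n : ℝ≥0∞) * v n < ∞ := by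
  refine ENNReal.add_lt_top.2 ⟨ENNReal.coe_lt_top, lt_top_iff_ne_top.2 ?_⟩
  simpa only [ENNReal.coe_mul] using ENNReal.tsum_coe_ne_top_iff_summable.2 h

theorem Tiling.wordLength_inv_mul_le {k : ℕ → ℕ} {G : Type*} [Group G] {D : Tiling k G}
    {S₀ S : Set G} {w : ℕ → ℕ} (hw : ∀ n, ∀ g ∈ D.T n, WordLE S₀ (w n) g) {C : ℕ}
    (hC : ∀ n g, WordLE S₀ n g → WordLE S (C * n) g) {n : ℕ} {a b : G} (ha : a ∈ D.T n)
    (hb : b ∈ D.T n) : wordLength S (a⁻¹ * b) ≤ 2 * C * w n := by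
  have h := ((hC _ _ (hw n a ha)).inv.mul (hC _ _ (hw n b hb))).wordLength_le
  linarith

theorem two_pow_div_le (n d : ℕ) : (2 : ℝ) ^ (n / d) ≤ 2 ^ ((n : ℝ) / d) := by
  rw [← Real.rpow_natCast]
  exact Real.rpow_le_rpow_of_exponent_le one_le_two Nat.cast_div_le

theorem inv_two_pow_div_le {n d : ℕ} (hd : 1 ≤ d) :
    ((2 : ℝ) ^ (n / d))⁻¹ ≤ 2 * 2 ^ (-((n : ℝ) / d)) := by
  rw [Real.rpow_neg two_pos.le, ← div_eq_mul_inv, ← one_div,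
    div_le_div_iff₀ (by positivity) (by positivity), one_mul, ← pow_succ', ← Real.rpow_natCast]
  refine Real.rpow_le_rpow_of_exponent_le one_le_two ?_
  have hd0 : (0 : ℝ) < d := by exact_mod_cast hd
  rw [div_le_iff₀ hd0]
  have h : n ≤ (n / d + 1) * d := by
    have := Nat.lt_div_mul_add (a := n) (b := d) hd
    linarith
  exact_mod_cast h

theorem boundary_boxTiling_two_le (d : ℕ) [NeZero d] (z : FreeAb d) (n : ℕ) :
    ((boxTiling d fun _ => 2).boundary z n : ℝ)
      ≤ (∑ j, ((z.toAdd j).natAbs : ℝ)) * 2 * 2 ^ (-((n : ℝ) / d)) := by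
  refine (NNReal.coe_le_coe.2 (boundary_boxTiling_le d (fun _ => 2) z n)).trans ?_
  rw [NNReal.coe_sum, mul_assoc, Finset.sum_mul]
  refine Finset.sum_le_sum fun j _ => ?_
  rw [NNReal.coe_div, NNReal.coe_natCast, NNReal.coe_natCast, div_eq_mul_inv]
  refine mul_le_mul_of_nonneg_left ?_ (Nat.cast_nonneg _)
  refine le_trans (inv_anti₀ (by positivity) ?_) (inv_two_pow_div_le (NeZero.one_le (n := d)))
  exact_mod_cast le_boxSide d n j

theorem boundary_boxTiling_le_of_le (d : ℕ) [NeZero d] {k : ℕ → ℕ} [∀ n, NeZero (k n)]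
    (hk : ∀ n, 1 ≤ n → 2 ^ (n * 2 ^ n) ≤ k n) (z : FreeAb d) {n : ℕ} (hn : 1 ≤ n) :
    ((boxTiling d k).boundary z (n + d) : ℝ)
      ≤ (∑ j, ((z.toAdd j).natAbs : ℝ)) / 2 ^ (n * 2 ^ n) := by
  refine (NNReal.coe_le_coe.2 (boundary_boxTiling_le d k z _)).trans ?_
  rw [NNReal.coe_sum, Finset.sum_div]
  refine Finset.sum_le_sum fun j _ => ?_
  rw [NNReal.coe_div, NNReal.coe_natCast, NNReal.coe_natCast]
  refine div_le_div_of_nonneg_left (Nat.cast_nonneg _) (by positivity) ?_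
  obtain ⟨m, hm, _, hkm⟩ := exists_le_boxSide d (k := k) n j
  have h1 : 2 ^ (n * 2 ^ n) ≤ boxSide d k (n + d) j := by
    refine le_trans ?_ ((hk m (hn.trans hm)).trans hkm)
    exact Nat.pow_le_pow_right two_pos
      (Nat.mul_le_mul hm (Nat.pow_le_pow_right two_pos hm))
  exact_mod_cast h1

/-- There are about 2^n transpositions to perform, each of length of the order of the side 2^(n/d).
-/
theorem lampTile_length_le (d r n : ℕ) [NeZero d] :
    (∏ j : Fin d, boxSide d (fun _ => 2) n j) * r *
        (3 * (1 + 6 * ∑ j : Fin d, boxSide d (fun _ => 2) n j))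
        + ∑ j : Fin d, boxSide d (fun _ => 2) n j
      ≤ (r * (3 + 36 * d) + 2 * d) * (2 ^ n * 2 ^ (n / d)) := by
  have h1 : ∏ j : Fin d, boxSide d (fun _ => 2) n j = 2 ^ n := by
    rw [prod_boxSide]
    simp
  have h2 : ∑ j : Fin d, boxSide d (fun _ => 2) n j ≤ d * (2 * 2 ^ (n / d)) := by
    rw [← pow_succ']
    exact (Finset.sum_le_card_nsmul _ _ _ fun j _ => boxSide_le d n j).trans_eq (by simp)
  rw [h1]
  have h3 : 1 ≤ 2 ^ n := Nat.one_le_two_pow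
  have h4 : 1 ≤ 2 ^ (n / d) := Nat.one_le_two_pow
  generalize 2 ^ n = N at *
  generalize 2 ^ (n / d) = p at *
  calc _ ≤ N * r * (3 * (p + 6 * (d * (2 * p)))) + N * (d * (2 * p)) := by
        refine Nat.add_le_add ?_ (h2.trans (Nat.le_mul_of_pos_left _ h3))
        gcongr
    _ = _ := by ring

/-! ### The coupling and its integrability -/

theorem isFolner_of_le {k : ℕ → ℕ} {G : Type*} [Group G] {D : Tiling k G} {e : ℕ} {u : ℕ → ℝ}
    (hu : Tendsto u atTop (nhds 0))
    (h : ∀ g, ∃ C : ℝ, ∀ n, 1 ≤ n → (D.boundary g (n + e) : ℝ) ≤ C * u n) : D.IsFolner := by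
  intro g
  obtain ⟨C, hC⟩ := h g
  rw [← NNReal.tendsto_coe, ← tendsto_add_atTop_iff_nat e]
  refine squeeze_zero' (Eventually.of_forall fun n => NNReal.coe_nonneg _) ?_
    (by simpa using hu.const_mul C)
  filter_upwards [eventually_ge_atTop 1] with n hn
  exact hC n hn

theorem mainTheorem8 (d₁ d₂ r : ℕ) (hd₁ : 1 ≤ d₁) (hd₂ : 1 ≤ d₂) (hr : 1 ≤ r) :
    ∃ C : OECoupling (Lampjuggler r (FreeAb d₁)) (FreeAb d₂),
      ∀ ε : ℝ, 0 < ε →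
      ∀ φ ψ : ℝ≥0 → ℝ≥0, Monotone φ → Monotone ψ →
        (∀ᶠ x : ℝ≥0 in atTop, (φ x : ℝ) =
          Real.log x ^ (1 / (d₁ : ℝ)) / Real.log (Real.log x) ^ (1 + 1 / (d₁ : ℝ) + ε)) →
        (∀ᶠ x : ℝ≥0 in atTop, (ψ x : ℝ) =
          (x : ℝ) ^ ((x : ℝ) ^ ((d₁ : ℝ) / ((d₁ : ℝ) + 1)))) →
        C.IsIntegrable φ ψ := by
  have : NeZero d₁ := ⟨by omega⟩
  have : NeZero d₂ := ⟨by omega⟩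
  have : NeZero r := ⟨by omega⟩
  have hd0 : (0 : ℝ) < d₁ := by exact_mod_cast hd₁
  obtain ⟨k, hk, D, hD⟩ := exists_lampTiling (r := r) (boxTiling d₁ fun _ => 2)
  have hQ (n : ℕ) (hn : 1 ≤ n) :
      ∏ i ∈ Finset.range n, k i = (2 ^ n * r).factorial * 2 ^ n := by
    rw [← D.card_T, hD, card_lampTile, lampSupport, if_neg (by omega), Tiling.card_T]
    simp
  have hkn (n : ℕ) (hn : 1 ≤ n) : 2 ^ (n * 2 ^ n) ≤ k n := two_pow_le_of_prod_eq hr hQ hn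
  have hDb (g : Lampjuggler r (FreeAb d₁)) : ∃ C : ℝ, ∀ n, 1 ≤ n →
      (D.boundary g n : ℝ) ≤ C * 2 ^ (-((n : ℝ) / d₁)) := by
    obtain ⟨P, hP⟩ := exists_boundary_lampTiling_le hD g
    refine ⟨∑ w ∈ P, (∑ j, ((w.toAdd j).natAbs : ℝ)) * 2, fun n hn => ?_⟩
    refine (NNReal.coe_le_coe.2 (hP n hn)).trans ?_
    rw [NNReal.coe_sum, Finset.sum_mul]
    exact Finset.sum_le_sum fun w _ => boundary_boxTiling_two_le d₁ w n
  have hEb (z : FreeAb d₂) {n : ℕ} (hn : 1 ≤ n) := boundary_boxTiling_le_of_le d₂ hkn z hn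
  have hDF : D.IsFolner := by
    refine isFolner_of_le (e := 0) (u := fun n : ℕ => 2 ^ (-((n : ℝ) / d₁))) ?_ hDb
    have h1 : Tendsto (fun n : ℕ => (n : ℝ) / d₁) atTop atTop :=
      tendsto_natCast_atTop_atTop.atTop_div_const hd0
    exact (tendsto_rpow_atBot_of_base_gt_one 2 one_lt_two).comp (tendsto_neg_atTop_atBot.comp h1)
  have hEF : (boxTiling d₂ k).IsFolner := by
    refine isFolner_of_le (e := d₂) (u := fun n : ℕ => ((2 : ℝ) ^ (n * 2 ^ n))⁻¹) ?_
      fun z => ⟨_, fun n hn => hEb z hn⟩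
    refine (tendsto_inv_atTop_zero (𝕜 := ℝ)).comp ((tendsto_pow_atTop_atTop_of_one_lt
      (one_lt_two (α := ℝ))).comp (tendsto_atTop_mono (fun n => ?_) tendsto_id))
    exact Nat.le_mul_of_pos_right _ (by positivity)
  have hprod : Tendsto (fun n => ∏ i ∈ Finset.range n, k i) atTop atTop := by
    refine tendsto_atTop_mono' atTop ?_ tendsto_id
    filter_upwards [eventually_ge_atTop 1] with n hn
    rw [hQ n hn]
    exact (Nat.lt_two_pow_self (n := n)).le.trans
      (Nat.le_mul_of_pos_left _ (Nat.factorial_pos _))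
  have hDw (n : ℕ) (g : Lampjuggler r (FreeAb d₁)) (hg : g ∈ D.T n) :
      WordLE (lampGen r d₁) ((r * (3 + 36 * d₁) + 2 * d₁) * (2 ^ n * 2 ^ (n / d₁))) g := by
    rw [hD] at hg
    refine (wordLE_of_mem_lampTile ?_ hg).mono (lampTile_length_le d₁ r n)
    rw [lampSupport]
    split_ifs
    · exact Finset.empty_subset _
    · exact Finset.Subset.refl _
  have hEw (n : ℕ) (g : FreeAb d₂) (hg : g ∈ (boxTiling d₂ k).T n) :
      WordLE (Set.range stdGen) (d₂ * ∏ i ∈ Finset.range n, k i) g :=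
    (wordLE_of_mem_box hg).mono (sum_boxSide_le d₂ k n)
  refine ⟨tilingCoupling hDF hEF hprod, fun ε hε φ ψ hφm hψm hφ hψ => ⟨?_, ?_, ?_, ?_⟩⟩
  · exact Group.fg_iff.2 ⟨lampGen r d₁,
      hDF.closure_eq_top fun n g hg => (hDw n g hg).mem_closure, finite_lampGen r d₁⟩
  · exact Group.fg_iff.2 ⟨Set.range stdGen,
      hEF.closure_eq_top fun n g hg => (hEw n g hg).mem_closure, Set.finite_range _⟩
  · intro S _ hS g
    obtain ⟨C, hC0, hC⟩ := WordLE.exists_of_finite hS (Set.finite_range (stdGen (d := d₂)))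
    set M : ℝ≥0 := 2 * C * d₂ with hM
    have hM0 : 0 < M := by
      have : (0 : ℝ≥0) < C := by exact_mod_cast hC0
      have : (0 : ℝ≥0) < d₂ := by exact_mod_cast hd₂
      positivity
    -- With this constant the rescaled length bound is exactly the cardinality of the tile.
    refine ⟨M, hM0, ?_⟩
    refine (lintegral_cocycleHK_le hDF hEF hprod g
      (W := fun n => M * (∏ i ∈ Finset.range n, k i : ℕ)) ?_ hφm M).trans_lt ?_
    · intro n a ha b hb
      have := Tiling.wordLength_inv_mul_le hEw hC ha hb
      rw [hM]
      calc (wordLength S (a⁻¹ * b) : ℝ≥0) ≤ (2 * C * (d₂ * ∏ i ∈ Finset.range n, k i) : ℕ) := by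
            exact_mod_cast this
        _ = _ := by push_cast; ring
    · refine coe_add_tsum_lt_top _ ?_
      simp only [mul_div_cancel_left₀ _ hM0.ne']
      obtain ⟨C', hC'⟩ := hDb g
      refine summable_log_profile hd₁ hε hφm hφ (A := 2 * r * (2 + r) + 2) (by omega)
        (Q := fun n => ((∏ i ∈ Finset.range n, k i : ℕ) : ℝ≥0)) (fun n hn => ?_) hC'
      have := factorial_mul_pow_le (r := r) hn
      rw [← hQ (n + 1) (by omega)] at this
      exact_mod_cast this
  · intro S _ hS z
    obtain ⟨C, hC0, hC⟩ := WordLE.exists_of_finite hS (finite_lampGen r d₁)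
    obtain ⟨δ, hδ0, hδ⟩ := exists_summable_exp_profile hd₁ hψ (e := d₂)
      (b := (boxTiling d₂ k).boundary z) fun n hn => hEb z hn
    set M : ℝ≥0 := 2 * C * (r * (3 + 36 * d₁) + 2 * d₁) with hM
    have hM0 : 0 < M := by
      have : (0 : ℝ≥0) < C := by exact_mod_cast hC0
      have : (0 : ℝ≥0) < d₁ := by exact_mod_cast hd₁
      positivity
    have hp0 : (0 : ℝ≥0) < 2 ^ (1 + 1 / (d₁ : ℝ)) := NNReal.rpow_pos two_pos
    -- The factor `2 ^ (1 + 1 / d₁)` absorbs the passage from level `n` to level `n + 1`; dividing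
    -- by `δ` gives the argument for which the series converges.
    refine ⟨M * 2 ^ (1 + 1 / (d₁ : ℝ)) / δ, by positivity, ?_⟩
    refine (lintegral_cocycleKH_le hDF hEF hprod z
      (W := fun n => M * 2 ^ ((n : ℝ) * (1 + 1 / (d₁ : ℝ)))) ?_ hψm _).trans_lt ?_
    · intro n a ha b hb
      have := Tiling.wordLength_inv_mul_le hDw hC ha hb
      have h2 : (2 ^ n * 2 ^ (n / d₁) : ℝ≥0) ≤ 2 ^ ((n : ℝ) * (1 + 1 / (d₁ : ℝ))) := by
        rw [← NNReal.coe_le_coe]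
        push_cast
        rw [mul_add, mul_one, mul_one_div, Real.rpow_add two_pos, Real.rpow_natCast]
        gcongr
        exact two_pow_div_le n d₁
      calc (wordLength S (a⁻¹ * b) : ℝ≥0)
          ≤ (2 * C * ((r * (3 + 36 * d₁) + 2 * d₁) * (2 ^ n * 2 ^ (n / d₁))) : ℕ) := by
            exact_mod_cast this
        _ = M * (2 ^ n * 2 ^ (n / d₁)) := by rw [hM]; push_cast; ring
        _ ≤ _ := by gcongr
    · refine coe_add_tsum_lt_top _ ?_
      refine hδ.congr fun n => ?_
      congr 2
      push_cast
      rw [add_mul, one_mul, NNReal.rpow_add two_ne_zero]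
      field_simp
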